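/- All spaces are Tychonoff. A zero-set is the zero locus of a continuous real-valued function, and a cozero-set is the complement of a zero-set. A space is an \emph{$F$-space} if any two disjoint cozero-sets are contained in disjoint zero-sets, and \emph{zero-dimensional} if its clopen sets form a base. A closed set $A\subseteq X$ is a \emph{$P$-set} if the intersection of countably many neighbourhoods of $A$ is again a neighbourhood of $A$; it is \emph{nicely placed} in $X$ if every open $O\supseteq A$ contains a cozero-set of $X$ that contains $A$. A set $A\subseteq X$ is \emph{$C^*$-embedded} in $X$ if every continuous $f:A\to[0,1]$ extends to a continuous map $X\to[0,1]$. For a cardinal $\kappa$ let $\mathrm{(UT)}_\kappa$ be the assertion: every Tychonoff space that has a cover consisting of at most $\kappa$ many $P$-sets, each of which is a nicely placed $C^*$-embedded $F$-subspace, is an $F$-space. \textbf{Construction.} Let $G$ be the quotient of the topological sum of $\mathbb N^*\times(\omega_1+1)$ and $\beta\mathbb N$ obtained by identifying $(u,\omega_1)$ with $u$ for every $u\in\mathbb N^*=\beta\mathbb N\setminus\mathbb N$. Put $Y=\omega\times G$ and let $\pi^*:Y^*\to G$ be the restriction to $Y^*=\beta Y\setminus Y$ of the Stone extension of the projection $Y\to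 G$. Let $f$ be the restriction of $\pi^*$ to $(\pi^*)^{-1}[\beta\mathbb N]$ and let $\Omega=Y^*\cup_f\beta\mathbb N$ be the adjunction space. Let $C=\omega\subseteq\beta\mathbb N\subseteq\Omega$ and, for $\alpha<\omega_1$, let $V_\alpha\subseteq\Omega$ be the image of $(\pi^*)^{-1}\bigl[\mathbb N^*\times[0,\alpha]\bigr]$. Let $X=(\omega_2+1)_\delta$ be the set $\omega_2+1$ with the topology that has the $G_\delta$-sets of the order topology as a base, and let $L=\{\alpha\in X:\operatorname{cf}\alpha\ge\omega_1\}$. Finally put $K=\beta(X\times\Omega)$, $T=\operatorname{cl}_K(L\times C)$ and $U=K\setminus T$. \textbf{Theorem.} \begin{enumerate} \item $\Omega$ and $K$ are compact Hausdorff zero-dimensional $F$-spaces. \item $U$ is an open, locally compact subspace of $K$, and $U$ is not an $F$-space. \item There is a family $\mathcal A$ of cardinality $\aleph_2$, consisting of countably infinite subsets of $X\setminus L$, such that every countable subset of $X\setminus L$ is contained in a member of $\mathcal A$, and such that the family $$\mathcal F=\{\operatorname{cl}_K(X\times V_\alpha):\alpha<\omega_1\}\cup\{\operatorname{cl}_K(A\times\Omega):A\in\mathcal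 A\}$$ has cardinality $\aleph_2$ and union $U$, while every member of $\mathcal F$ is clopen in $K$, is a compact zero-dimensional $F$-space, and is a nicely placed, $C^*$-embedded $P$-set in $U$. \item Consequently $\mathrm{(UT)}_{\aleph_2}$ is false. \end{enumerate} -/

import Mathlib

open Set Topology
open scoped Cardinal Ordinal

namespace FUnion

/-! ## Special subsets of topological spaces, and F-spaces -/

section General

variable {X : Type*} [TopologicalSpace X]

/-- Zero-sets: zero loci of continuous real-valued functions. -/
def IsZeroSet (s : Set X) : Prop := ∃ f : C(X, ℝ), s = {x | f x = 0}

/-- Cozero-sets: complements of zero-sets. -/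
def IsCozeroSet (s : Set X) : Prop := ∃ f : C(X, ℝ), s = {x | f x ≠ 0}

/-- A `P`-set: a closed set such that countable intersections of its neighbourhoods are
neighbourhoods of it. -/
def IsPSet (A : Set X) : Prop :=
  IsClosed A ∧ ∀ S : ℕ → Set X, (∀ n, S n ∈ 𝓝ˢ A) → (⋂ n, S n) ∈ 𝓝ˢ A

/-- A nicely placed set: a closed set whose cozero neighbourhoods form a neighbourhood base. -/
def IsNicelyPlaced (A : Set X) : Prop :=
  IsClosed A ∧ ∀ U : Set X, IsOpen U → A ⊆ U → ∃ V : Set X, IsCozeroSet V ∧ A ⊆ V ∧ V ⊆ U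

/-- `C*`-embedded sets: continuous maps to the unit interval extend. -/
def IsCStarEmbedded (A : Set X) : Prop :=
  ∀ f : C(A, unitInterval), ∃ g : C(X, unitInterval), ∀ a : A, g a = f a

variable (X) in
/-- `F`-spaces: disjoint cozero-sets are contained in disjoint zero-sets. -/
def IsFSpace : Prop :=
  ∀ U V : Set X, IsCozeroSet U → IsCozeroSet V → Disjoint U V →
    ∃ Z W : Set X, IsZeroSet Z ∧ IsZeroSet W ∧ U ⊆ Z ∧ V ⊆ W ∧ Disjoint Z W

variable (X) in
/-- Zero-dimensional spaces: the clopen sets form a base. -/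
def IsZeroDim : Prop := TopologicalSpace.IsTopologicalBasis {s : Set X | IsClopen s}

end General

/-- The union theorem for covers of size at most `κ`: a Tychonoff space with a cover by at most
`κ` many nicely placed `C*`-embedded `P`-sets, each of which is an `F`-space, is an `F`-space. -/
def UnionTheorem (κ : Cardinal.{0}) : Prop :=
  ∀ (X : Type) [TopologicalSpace X] [T35Space X] (F : Set (Set X)),
    #F ≤ κ → ⋃₀ F = univ →
    (∀ A ∈ F, IsPSet A ∧ IsNicelyPlaced A ∧ IsCStarEmbedded A ∧ IsFSpace A) →
    IsFSpace X

/-! ## Ordinal spaces -/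

/-- The set `o + 1 = {α | α ≤ o}`, with its order and with the order topology. -/
def OrdSpace (o : Ordinal.{0}) : Type := (Order.succ o).ToType

noncomputable section

instance (o : Ordinal.{0}) : LinearOrder (OrdSpace o) :=
  inferInstanceAs (LinearOrder (Order.succ o).ToType)

instance (o : Ordinal.{0}) : WellFoundedLT (OrdSpace o) :=
  inferInstanceAs (WellFoundedLT (Order.succ o).ToType)

instance (o : Ordinal.{0}) : OrderTop (OrdSpace o) :=
  inferInstanceAs (OrderTop (Order.succ o).ToType)

instance (o : Ordinal.{0}) : TopologicalSpace (OrdSpace o) := Preorder.topology _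

instance (o : Ordinal.{0}) : OrderTopology (OrdSpace o) := ⟨rfl⟩

instance (o : Ordinal.{0}) : CompactSpace (OrdSpace o) := by
  let _ : OrderBot (OrdSpace o) :=
    { bot := wellFounded_lt.min univ ⟨⊤, trivial⟩
      bot_le := fun a => wellFounded_lt.min_le (mem_univ a) }
  let _ := WellFoundedLT.conditionallyCompleteLinearOrderBot (OrdSpace o)
  constructor
  have h : (univ : Set (OrdSpace o)) = Icc ⊥ ⊤ := by ext; simp
  rw [h]
  exact isCompact_Icc

/-- The ordinal corresponding to a point of `o + 1`. -/
def OrdSpace.toOrdinal {o : Ordinal.{0}} (x : OrdSpace o) : Ordinal.{0} :=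
  (Ordinal.ToType.toOrd (o := Order.succ o) x : Ordinal.{0})

/-! ## Adjunction spaces and remainders -/

/-- The adjunction space `X ∪_f Z`, where `f` maps the subspace `A` of `X` to `Z`: the quotient
of the topological sum of `X` and `Z` in which each `a` in `A` is identified with `f a`. -/
def Adjunction {X Z : Type} (A : Set X) (f : A → Z) : Type :=
  Quot (fun p q : X ⊕ Z => ∃ a : A, p = Sum.inl (a : X) ∧ q = Sum.inr (f a))

namespace Adjunction

variable {X Z : Type} (A : Set X) (f : A → Z)

instance [TopologicalSpace X] [TopologicalSpace Z] : TopologicalSpace (Adjunction A f) :=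
  inferInstanceAs (TopologicalSpace (Quot _))

instance [TopologicalSpace X] [TopologicalSpace Z] [CompactSpace X] [CompactSpace Z] :
    CompactSpace (Adjunction A f) :=
  inferInstanceAs (CompactSpace (Quot _))

/-- The canonical map `X → X ∪_f Z`. -/
def left (x : X) : Adjunction A f := Quot.mk _ (Sum.inl x)

/-- The canonical map `Z → X ∪_f Z`. -/
def right (z : Z) : Adjunction A f := Quot.mk _ (Sum.inr z)

end Adjunction

/-- The Čech–Stone remainder `X* = βX \ X`. -/
abbrev Remainder (X : Type) [TopologicalSpace X] : Type :=
  {p : StoneCech X // p ∉ range (stoneCechUnit : X → StoneCech X)}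

theorem isOpen_range_unit_nat : IsOpen (range (stoneCechUnit : ℕ → StoneCech ℕ)) := by
  rw [isOpen_iff_forall_mem_open]
  rintro _ ⟨n, rfl⟩
  have hg : Continuous (fun m : ℕ => decide (m = n)) := continuous_of_discreteTopology
  have ho : IsOpen (stoneCechExtend hg ⁻¹' {true}) :=
    (isOpen_discrete _).preimage (continuous_stoneCechExtend hg)
  refine ⟨_, ?_, ho, ?_⟩
  · intro p hp
    have h1 : p ∈ closure (stoneCechExtend hg ⁻¹' {true} ∩ range stoneCechUnit) :=
      (denseRange_stoneCechUnit (α := ℕ)).open_subset_closure_inter ho hp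
    have h2 : (stoneCechExtend hg ⁻¹' {true} ∩ range stoneCechUnit : Set (StoneCech ℕ))
        ⊆ {stoneCechUnit n} := by
      rintro _ ⟨hm, m, rfl⟩
      simp at hm
      simp [hm]
    have h3 := closure_mono h2 h1
    rw [closure_singleton] at h3
    exact ⟨n, h3.symm⟩
  · simp

instance : CompactSpace (Remainder ℕ) :=
  isCompact_iff_compactSpace.mp isOpen_range_unit_nat.isClosed_compl.isCompact

/-! ## The space `G` -/

/-- The subset `ℕ* × {ω₁}` of `ℕ* × (ω₁ + 1)`. -/
def topLevel : Set (Remainder ℕ × OrdSpace (ω_ 1)) := {p | p.2 = ⊤}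

/-- `G` is the sum of `ℕ* × (ω₁ + 1)` and `βℕ` with `(u, ω₁)` identified with `u`, for all `u`
in `ℕ*`. -/
abbrev G : Type := Adjunction topLevel (fun p => (p.1.1 : StoneCech ℕ))

/-- The copy of `βℕ` in `G`. -/
def betaNatG : Set G := range (Adjunction.right _ _)

/-- The initial segment `ℕ* × [0, α]` in `G`. -/
def segG (α : OrdSpace (ω_ 1)) : Set G := Adjunction.left _ _ '' {p | p.2 ≤ α}

/-- The map from `G` to `βℕ × (ω₁ + 1)` that sends `(u, α)` to itself, and `p` in `βℕ` to
`(p, ω₁)`. It serves to show that `G` is Hausdorff. -/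
def toProd : G → StoneCech ℕ × OrdSpace (ω_ 1) :=
  Quot.lift (Sum.elim (fun p => (p.1.1, p.2)) (fun z => (z, ⊤))) (by
    rintro _ _ ⟨⟨a, ha⟩, rfl, rfl⟩
    exact Prod.ext rfl ha)

theorem continuous_toProd : Continuous toProd := by
  refine continuous_quot_lift _ (Continuous.sumElim ?_ ?_)
  · exact (continuous_subtype_val.comp continuous_fst).prodMk continuous_snd
  · exact continuous_id.prodMk continuous_const

theorem right_injective :
    Function.Injective (Adjunction.right topLevel (fun p => (p.1.1 : StoneCech ℕ))) := by
  intro z w h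
  have h' : ((z, ⊤) : StoneCech ℕ × OrdSpace (ω_ 1)) = (w, ⊤) := congrArg toProd h
  exact (Prod.ext_iff.mp h').1

theorem injective_toProd : Function.Injective toProd := by
  have key : ∀ (p : Remainder ℕ × OrdSpace (ω_ 1)) (z : StoneCech ℕ),
      toProd (Adjunction.left _ _ p) = toProd (Adjunction.right _ _ z) →
      (Adjunction.left _ _ p : G) = Adjunction.right _ _ z := by
    intro p z h
    have h' : ((p.1.1, p.2) : StoneCech ℕ × OrdSpace (ω_ 1)) = (z, ⊤) := h
    obtain ⟨h1, h2⟩ := Prod.ext_iff.mp h'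
    exact Quot.sound ⟨⟨p, h2⟩, rfl, congrArg Sum.inr h1.symm⟩
  rintro ⟨p | z⟩ ⟨q | w⟩ h
  · have h' : ((p.1.1, p.2) : StoneCech ℕ × OrdSpace (ω_ 1)) = (q.1.1, q.2) := h
    obtain ⟨h1, h2⟩ := Prod.ext_iff.mp h'
    have hpq : p = q := Prod.ext (Subtype.ext h1) h2
    exact congrArg (Adjunction.left _ _) hpq
  · exact key p w h
  · exact (key q z h.symm).symm
  · have h' : ((z, ⊤) : StoneCech ℕ × OrdSpace (ω_ 1)) = (w, ⊤) := h
    exact congrArg (Adjunction.right _ _) (Prod.ext_iff.mp h').1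

instance : T2Space G := .of_injective_continuous injective_toProd continuous_toProd

/-! ## The space `Ω` -/

/-- `Y = ω × G`. -/
abbrev Y : Type := ℕ × G

/-- `π* : Y* → G`, the restriction of the Stone extension of the projection `Y → G`. -/
def piStar (y : Remainder Y) : G :=
  stoneCechExtend (continuous_snd : Continuous (Prod.snd : Y → G)) y.1

/-- The preimage of `βℕ` under `π*`. -/
def preBetaNat : Set (Remainder Y) := piStar ⁻¹' betaNatG

/-- The restriction of `π*` to the preimage of `βℕ`, as a map to `βℕ`: the point `restr y` is the
unique one whose copy in `G` is `π* y`, see `right_restr` and `right_injective`. -/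
def restr (y : preBetaNat) : StoneCech ℕ := Classical.choose y.2

theorem right_restr (y : preBetaNat) : Adjunction.right _ _ (restr y) = piStar y.1 :=
  Classical.choose_spec y.2

/-- `Ω = Y* ∪_f βℕ`. -/
abbrev Omega : Type := Adjunction preBetaNat restr

/-- The countable subset `C = ω` of the copy of `βℕ` in `Ω`. -/
def C : Set Omega := range (fun n : ℕ => Adjunction.right _ _ (stoneCechUnit n))

/-- The subset `V_α` of `Ω` that corresponds to the preimage of `ℕ* × [0, α]` in `Y*`. -/
def V (α : OrdSpace (ω_ 1)) : Set Omega := Adjunction.left _ _ '' (piStar ⁻¹' segG α)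

/-! ## The spaces `K` and `U` -/

/-- `(ω₂ + 1)_δ`: the ordinal space `ω₂ + 1` with the topology whose base consists of the `G_δ`-sets
of the order topology. -/
def X : Type := OrdSpace (ω_ 2)

instance : TopologicalSpace X :=
  TopologicalSpace.generateFrom {s : Set (OrdSpace (ω_ 2)) | IsGδ s}

/-- The set of points of `ω₂ + 1` of uncountable cofinality. -/
def L : Set X := {x | ℵ₁ ≤ (OrdSpace.toOrdinal (o := ω_ 2) x).cof}

/-- `K = β((ω₂ + 1)_δ × Ω)`. -/
abbrev K : Type := StoneCech (X × Omega)

/-- The closure in `K` of a subset of `X × Ω`. -/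
def clK (s : Set (X × Omega)) : Set K := closure (stoneCechUnit '' s)

/-- The closed set `T`. -/
def T : Set K := clK (L ×ˢ C)

/-- The complement of `T`. -/
def U : Set K := Tᶜ

end

end FUnion

/-!
A space is an `F`-space exactly when the signs of every continuous real function can be separated by
a continuous function (`isFSpace_iff_exists_separating`), and every `F`-space below is found in this
form.

*The spaces `Ω` and `K` are `F`-spaces.* If `F` extends a function on `Y*` to `βY`, then truncating
`(n + 1) F` on the `n`-th copy of `G` separates its signs on `Y*` (`isFSpace_remainder_nat_prod`).
The coordinates of `G`, as a subspace of `βℕ × (ω₁ + 1)`, yield a retraction `Omega.ret` of `Ω` onto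
`βℕ` and a map `Omega.level` to `ω₁ + 1`; the set `V α` is the clopen set where the level is at
most `α`, and the copy of `βℕ` is the set of points of level `ω₁`. As `cf ω₁ > ω`, that copy is
a `P`-set in `Ω` (`Omega.exists_level_le_of_isClosed`). On the extremally disconnected space `βℕ`
the signs of a function are separated by a clopen set; its preimage under the retraction separates
them in `Ω` outside some `V α`, and `V α` is a clopen part of `Y*` (`Omega.isFSpace`). In `X × Ω`, a
continuous function `f` determines a map from the `P`-space `X` to the metric space `C(Ω, ℝ)`, which
is locally constant (`IsPSpace.isLocallyConstant_curry`). So separation passes from `Ω` to `X × Ω`,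
and from there to `K = β(X × Ω)`. The same argument proves that `K` is zero-dimensional.

*The cover.* Points of `X` off `L` are isolated, and countable subsets of the complement of `L` are
clopen. A point of `U` lies in the closure of a clopen set `D` of `X × Ω` disjoint from `L × C`.
Since `C` is dense in `βℕ`, the sections of `D` over `L` are contained in sets `V α`; sections being
locally constant and `L` being Lindelöf, `D` is contained in the union of some `X × V α` and some
`A × Ω` with `A` countable (`exists_subset_of_disjoint`). Hence `U` is the union of the closures of
these sets. They are clopen, which makes them nicely placed `C*`-embedded `P`-sets. Finally, the
countable subsets of a set of size `ω₂` have a cofinal family of size `ω₂`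
(`hasCountableCofinal_aleph_two`).

*`U` is not an `F`-space* (`not_isFSpace_U`). Split the complement of `L` into two sets `S` and `R`,
both unbounded in `ω₂`. The unions of the clopen sets `layer S n` and of the clopen sets `layer R n`
are disjoint cozero-sets of `U`, which contain `S × C` and `R × C`. A function `h` that is `1` on
the first and `0` on the second is close to `1` on `{x} × (Ω \ V α)`, for `x ∈ S` and some `α` that
depends on `x`, and likewise close to `0` for points `x` of `R`. However, as `cf ω₂ > ω₁`, there is
a neighbourhood of the point `ω₂` in which `h (x, v)` is close to `h (ω₂, v)` for one point `v` of
each level below `ω₁`.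
-/

namespace FUnion

/-! ### `F`-spaces and separation of signs -/

section FSpace

variable {X Y Z : Type*} [TopologicalSpace X] [TopologicalSpace Y] [TopologicalSpace Z]

theorem exists_separating_of_disjoint
    (hX : ∀ f : C(X, ℝ), ∃ h : C(X, ℝ), (∀ x, 0 < f x → h x = 1) ∧ ∀ x, f x < 0 → h x = 0)
    {P Q : Set X} (hP : IsCozeroSet P) (hQ : IsCozeroSet Q) (hPQ : Disjoint P Q) :
    ∃ h : C(X, ℝ), (∀ x ∈ P, h x = 1) ∧ ∀ x ∈ Q, h x = 0 := by
  obtain ⟨a, rfl⟩ := hP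
  obtain ⟨b, rfl⟩ := hQ
  have hab : ∀ x, a x ≠ 0 → b x = 0 := fun x hx => by
    by_contra hx'
    exact Set.disjoint_left.mp hPQ hx hx'
  obtain ⟨h, h1, h0⟩ := hX ⟨fun x => |a x| - |b x|, a.continuous.abs.sub b.continuous.abs⟩
  refine ⟨h, fun x hx => h1 x (by simpa [hab x hx] using hx), fun x hx => h0 x ?_⟩
  have ha : a x = 0 := by
    by_contra ha
    exact hx (hab x ha)
  simpa [ha] using hx

/-- A space is an `F`-space exactly when the positive and the negative part of every continuous
function can be completely separated. This is the form in which the property is used below. -/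
theorem isFSpace_iff_exists_separating :
    IsFSpace X ↔ ∀ f : C(X, ℝ), ∃ h : C(X, ℝ),
      (∀ x, 0 < f x → h x = 1) ∧ ∀ x, f x < 0 → h x = 0 := by
  constructor
  · intro hX f
    obtain ⟨_, _, ⟨a, rfl⟩, ⟨b, rfl⟩, ha, hb, hab⟩ := hX {x | (f ⊔ 0) x ≠ 0} {x | (f ⊓ 0) x ≠ 0}
      ⟨_, rfl⟩ ⟨_, rfl⟩ (by
        rw [Set.disjoint_left]
        intro x hx hx'
        simp only [ContinuousMap.sup_apply, ContinuousMap.inf_apply, ContinuousMap.zero_apply,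
          mem_ofPred_eq] at hx hx'
        rcases le_total (f x) 0 with h | h
        · exact hx (max_eq_right h)
        · exact hx' (min_eq_right h))
    have hne : ∀ x, |a x| + |b x| ≠ 0 := by
      intro x hx
      have h1 := abs_nonneg (a x)
      have h2 := abs_nonneg (b x)
      exact Set.disjoint_left.mp hab (show a x = 0 from abs_eq_zero.mp (by linarith))
        (show b x = 0 from abs_eq_zero.mp (by linarith))
    refine ⟨⟨fun x => |b x| / (|a x| + |b x|), ?_⟩, fun x hx => ?_, fun x hx => ?_⟩
    · exact b.continuous.abs.div (a.continuous.abs.add b.continuous.abs) hne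
    · have h0 : a x = 0 := ha (by
        simp only [mem_ofPred_eq, ContinuousMap.sup_apply, ContinuousMap.zero_apply,
          max_eq_left hx.le]
        exact hx.ne')
      have := hne x
      simp only [h0, abs_zero, zero_add] at this
      simp [h0, div_self this]
    · have h0 : b x = 0 := hb (by
        simp only [mem_ofPred_eq, ContinuousMap.inf_apply, ContinuousMap.zero_apply,
          min_eq_left hx.le]
        exact hx.ne)
      simp [h0]
  · intro hX P Q hP hQ hPQ
    obtain ⟨h, h1, h0⟩ := exists_separating_of_disjoint hX hP hQ hPQ
    refine ⟨{x | (h - 1) x = 0}, {x | h x = 0}, ⟨_, rfl⟩, ⟨_, rfl⟩, fun x hx => ?_, h0, ?_⟩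
    · simp [h1 x hx]
    · rw [Set.disjoint_left]
      intro x hx hx'
      simp only [mem_ofPred_eq, ContinuousMap.sub_apply, ContinuousMap.one_apply] at hx hx'
      simp [hx'] at hx

/-- Continuous maps extend from (embedded copies of) clopen sets. -/
theorem exists_extension_of_isClopen_range {e : X → Y} (he : IsEmbedding e)
    (hr : IsClopen (range e)) (f : C(X, Z)) (z : Z) : ∃ g : C(Y, Z), ∀ x, g (e x) = f x := by
  have ho : IsOpenEmbedding e := ⟨he, hr.isOpen⟩
  refine ⟨⟨Function.extend e f fun _ => z, continuous_iff_continuousAt.mpr fun y => ?_⟩,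
    fun x => by exact he.injective.extend_apply f (fun _ => z) x⟩
  by_cases hy : y ∈ range e
  · obtain ⟨x, rfl⟩ := hy
    rw [← ho.continuousAt_iff, Function.extend_comp he.injective]
    exact f.continuous.continuousAt
  · have : (fun _ => z) =ᶠ[𝓝 y] Function.extend e f fun _ => z := by
      filter_upwards [hr.isClosed.isOpen_compl.mem_nhds hy] with y' hy'
      exact (Function.extend_apply' f (fun _ => z) y' hy').symm
    exact continuousAt_const.congr this

theorem IsFSpace.of_isClopen_range {e : X → Y} (he : IsEmbedding e) (hr : IsClopen (range e))
    (hY : IsFSpace Y) : IsFSpace X := by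
  rw [isFSpace_iff_exists_separating] at hY ⊢
  intro f
  obtain ⟨g, hg⟩ := exists_extension_of_isClopen_range he hr f 0
  obtain ⟨h, h1, h0⟩ := hY g
  exact ⟨h.comp ⟨e, he.continuous⟩, fun x hx => h1 (e x) (by rwa [hg]),
    fun x hx => h0 (e x) (by rwa [hg])⟩

/-- A countable union of clopen sets is a cozero-set. -/
theorem isCozeroSet_iUnion_of_isClopen {s : ℕ → Set X} (hs : ∀ n, IsClopen (s n)) :
    IsCozeroSet (⋃ n, s n) := by
  have hle : ∀ n x, (indicator (s n) (fun _ => (1 / 2 : ℝ) ^ n)) x ≤ (1 / 2) ^ n := fun n x =>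
    indicator_le_self' (fun _ _ => by positivity) x
  have hnn : ∀ n x, 0 ≤ (indicator (s n) (fun _ => (1 / 2 : ℝ) ^ n)) x := fun n x =>
    indicator_nonneg (fun _ _ => by positivity) x
  have hsum : Summable fun n : ℕ => (1 / 2 : ℝ) ^ n := summable_geometric_two
  refine ⟨⟨fun x => ∑' n, indicator (s n) (fun _ => (1 / 2 : ℝ) ^ n) x,
    continuous_tsum (fun n => continuous_const.indicator (by simp [(hs n).frontier_eq])) hsum
      fun n x => ?_⟩, ?_⟩
  · rw [Real.norm_of_nonneg (hnn n x)]
    exact hle n x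
  · ext x
    have hsx : Summable fun n => indicator (s n) (fun _ => (1 / 2 : ℝ) ^ n) x :=
      hsum.of_nonneg_of_le (fun n => hnn n x) fun n => hle n x
    simp only [ContinuousMap.coe_mk, mem_ofPred_eq, mem_iUnion, ne_eq]
    rw [← hsx.hasSum_iff.not.trans (Iff.rfl), hasSum_zero_iff_of_nonneg fun n => hnn n x]
    simp [funext_iff]

theorem isPSet_of_isClopen {D : Set X} (hD : IsClopen D) : IsPSet D := by
  refine ⟨hD.isClosed, fun S hS => ?_⟩
  refine Filter.mem_of_superset hD.isOpen.mem_nhdsSet_self ?_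
  exact subset_iInter fun n => subset_of_mem_nhdsSet (hS n)

theorem isNicelyPlaced_of_isClopen {D : Set X} (hD : IsClopen D) : IsNicelyPlaced D := by
  refine ⟨hD.isClosed, fun O _ hDO => ⟨D, ?_, subset_rfl, hDO⟩⟩
  simpa only [iUnion_const] using isCozeroSet_iUnion_of_isClopen fun _ : ℕ => hD

theorem isCStarEmbedded_of_isClopen {D : Set X} (hD : IsClopen D) : IsCStarEmbedded D := fun f =>
  exists_extension_of_isClopen_range IsEmbedding.subtypeVal (by simpa using hD) f 0

end FSpace

/-! ### Products of a `P`-space with a compact space -/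

section PSpace

variable {X Ω M : Type*} [TopologicalSpace X] [TopologicalSpace Ω]

/-- A `P`-space: countable intersections of open sets are open. -/
def IsPSpace (X : Type*) [TopologicalSpace X] : Prop :=
  ∀ S : ℕ → Set X, (∀ n, IsOpen (S n)) → IsOpen (⋂ n, S n)

theorem isPSpace_of_discreteTopology [DiscreteTopology X] : IsPSpace X := fun _ _ =>
  isOpen_discrete _

theorem IsPSpace.isOpen_biInter {ι : Type*} (hX : IsPSpace X) {s : Set ι} (hs : s.Countable)
    {O : ι → Set X} (hO : ∀ i ∈ s, IsOpen (O i)) : IsOpen (⋂ i ∈ s, O i) := by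
  rcases s.eq_empty_or_nonempty with rfl | hne
  · simp
  · obtain ⟨e, rfl⟩ := hs.exists_eq_range hne
    rw [biInter_range]
    exact hX _ fun n => hO _ (mem_range_self n)

theorem IsPSpace.isClosed_of_countable [T1Space X] (hX : IsPSpace X) {s : Set X}
    (hs : s.Countable) : IsClosed s := by
  rw [← isOpen_compl_iff]
  have : sᶜ = ⋂ x ∈ s, {x}ᶜ := by
    ext y
    simp only [mem_compl_iff, mem_iInter, mem_singleton_iff]
    exact ⟨fun h x hx hyx => h (hyx ▸ hx), fun h hy => h y hy rfl⟩
  rw [this]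
  exact hX.isOpen_biInter hs fun x _ => isClosed_singleton.isOpen_compl

/-- Continuous maps from a `P`-space to a metric space are locally constant, since points of the
latter are `G_δ`-sets. -/
theorem IsPSpace.isLocallyConstant [MetricSpace M] (hX : IsPSpace X) {g : X → M}
    (hg : Continuous g) : IsLocallyConstant g := by
  rw [IsLocallyConstant.iff_isOpen_fiber]
  intro m
  have : g ⁻¹' {m} = ⋂ n : ℕ, g ⁻¹' Metric.ball m (1 / (n + 1)) := by
    ext x
    simp only [mem_preimage, mem_singleton_iff, mem_iInter, Metric.mem_ball]
    refine ⟨fun h n => ?_, fun h => ?_⟩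
    · rw [h, dist_self]
      positivity
    · by_contra hne
      obtain ⟨n, hn⟩ := exists_nat_one_div_lt (dist_pos.mpr hne)
      exact lt_asymm hn (h n)
  rw [this]
  exact hX _ fun n => Metric.isOpen_ball.preimage hg

/-- A continuous function on the product of a `P`-space with a compact space depends, locally, only
on the second coordinate. -/
theorem IsPSpace.isLocallyConstant_curry [CompactSpace Ω] (hX : IsPSpace X) (f : C(X × Ω, ℝ)) :
    IsLocallyConstant f.curry :=
  hX.isLocallyConstant f.curry.continuous

theorem IsPSpace.isFSpace_prod [CompactSpace Ω] [T2Space Ω] (hX : IsPSpace X) (hΩ : IsFSpace Ω) :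
    IsFSpace (X × Ω) := by
  rw [isFSpace_iff_exists_separating] at hΩ ⊢
  intro f
  choose H H1 H0 using hΩ
  have hH : Continuous fun x => H (f.curry x) :=
    ((hX.isLocallyConstant_curry f).comp H).continuous
  exact ⟨ContinuousMap.uncurry ⟨_, hH⟩, fun p hp => H1 _ _ hp, fun p hp => H0 _ _ hp⟩

/-- Strongly zero-dimensional spaces, in the sense that completely separated sets can be separated
by clopen sets. -/
def IsStronglyZeroDim (X : Type*) [TopologicalSpace X] : Prop :=
  ∀ f : C(X, ℝ), ∃ D : Set X, IsClopen D ∧ (∀ x, f x ≤ 0 → x ∈ D) ∧ ∀ x ∈ D, f x < 1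

theorem isStronglyZeroDim_of_compactSpace [CompactSpace X] [T2Space X]
    [TotallyDisconnectedSpace X] : IsStronglyZeroDim X := by
  intro f
  have hc : IsClosed {x | f x ≤ 0} := isClosed_le f.continuous continuous_const
  have ho : IsOpen {x | f x < 1} := isOpen_lt f.continuous continuous_const
  obtain ⟨D, hD, h1, h2⟩ := exists_clopen_of_closed_subset_open hc ho
    fun x (hx : f x ≤ 0) => lt_of_le_of_lt hx one_pos
  exact ⟨D, hD, h1, h2⟩

theorem IsPSpace.isStronglyZeroDim_prod [CompactSpace Ω] (hX : IsPSpace X)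
    (hΩ : IsStronglyZeroDim Ω) : IsStronglyZeroDim (X × Ω) := by
  intro f
  choose H hH H0 H1 using hΩ
  -- near a point `p`, the set coincides with the cylinder over `H (f.curry p.1)`
  have key : ∀ A : C(Ω, ℝ) → Set Ω, (∀ φ, IsOpen (A φ)) →
      IsOpen {p : X × Ω | p.2 ∈ A (f.curry p.1)} := by
    intro A hA
    rw [isOpen_iff_mem_nhds]
    intro p hp
    have h1 : ∀ᶠ q : X × Ω in 𝓝 p, f.curry q.1 = f.curry p.1 :=
      continuous_fst.continuousAt.eventually ((hX.isLocallyConstant_curry f).eventually_eq p.1)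
    have h2 : ∀ᶠ q : X × Ω in 𝓝 p, q.2 ∈ A (f.curry p.1) :=
      continuous_snd.continuousAt.eventually ((hA _).mem_nhds hp)
    filter_upwards [h1, h2] with q hq1 hq2
    rwa [hq1]
  refine ⟨{p | p.2 ∈ H (f.curry p.1)}, ⟨?_, key H fun φ => (hH φ).isOpen⟩,
    fun p hp => H0 _ _ hp, fun p hp => H1 _ _ hp⟩
  rw [← isOpen_compl_iff]
  exact key (fun φ => (H φ)ᶜ) fun φ => (hH φ).compl.isOpen

end PSpace

/-! ### Čech–Stone compactifications -/

section StoneCech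

variable {Z : Type*} [TopologicalSpace Z]

theorem stoneCechExtend_unit {M : Type*} [TopologicalSpace M] [T2Space M] [CompactSpace M]
    {g : Z → M} (hg : Continuous g) (z : Z) : stoneCechExtend hg (stoneCechUnit z) = g z :=
  congrFun (stoneCechExtend_extends hg) z

/-- An open set of `βZ` lies in every closed set that contains its trace on `Z`. -/
theorem mem_of_isOpen_of_forall_unit {O E : Set (StoneCech Z)} (hO : IsOpen O) (hE : IsClosed E)
    (h : ∀ z : Z, stoneCechUnit z ∈ O → stoneCechUnit z ∈ E) {p : StoneCech Z} (hp : p ∈ O) :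
    p ∈ E := by
  refine closure_minimal ?_ hE
    ((denseRange_stoneCechUnit (α := Z)).open_subset_closure_inter hO hp)
  rintro _ ⟨hz, z, rfl⟩
  exact h z hz

/-- The closures in `βZ` of a clopen set of `Z` and of its complement are complementary. -/
theorem compl_closure_image_unit {D : Set Z} (hD : IsClopen D) :
    (closure (stoneCechUnit '' D))ᶜ = closure (stoneCechUnit '' Dᶜ) := by
  classical
  have hg : Continuous fun z => decide (z ∈ D) := by
    refine (IsLocallyConstant.iff_isOpen_fiber.mpr fun b => ?_).continuous
    cases b
    · simpa [preimage, ← compl_ofPred] using hD.compl.isOpen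
    · simpa [preimage] using hD.isOpen
  have hcl : ∀ (A : Set Z) (b : Bool), (∀ z ∈ A, decide (z ∈ D) = b) →
      closure (stoneCechUnit '' A) ⊆ {p | stoneCechExtend hg p = b} := by
    intro A b hA
    refine closure_minimal ?_ (isClosed_eq (continuous_stoneCechExtend hg) continuous_const)
    rintro _ ⟨z, hz, rfl⟩
    exact (stoneCechExtend_unit hg z).trans (hA z hz)
  refine subset_antisymm (fun p hp => ?_) fun p hp hp' => ?_
  · have : p ∈ closure (stoneCechUnit '' D ∪ stoneCechUnit '' Dᶜ) := by
      rw [← image_union, union_compl_self, image_univ]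
      exact denseRange_stoneCechUnit p
    rw [closure_union] at this
    exact this.resolve_left hp
  · have h1 : stoneCechExtend hg p = false := hcl Dᶜ false (fun z hz => by simpa using hz) hp
    have h2 : stoneCechExtend hg p = true := hcl D true (fun z hz => by simpa using hz) hp'
    simp [h1] at h2

theorem isClopen_closure_image_unit {D : Set Z} (hD : IsClopen D) :
    IsClopen (closure (stoneCechUnit '' D)) := by
  refine ⟨isClosed_closure, ?_⟩
  rw [← compl_compl (closure (stoneCechUnit '' D)), compl_closure_image_unit hD]
  exact isClosed_closure.isOpen_compl

theorem unit_mem_closure_image_iff {D : Set Z} (hD : IsClopen D) {z : Z} :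
    (stoneCechUnit z : StoneCech Z) ∈ closure (stoneCechUnit '' D) ↔ z ∈ D := by
  refine ⟨fun h => ?_, fun h => subset_closure (mem_image_of_mem _ h)⟩
  by_contra hz
  have : (stoneCechUnit z : StoneCech Z) ∈ closure (stoneCechUnit '' Dᶜ) :=
    subset_closure (mem_image_of_mem _ hz)
  rw [← compl_closure_image_unit hD] at this
  exact this h

/-- Clopen sets of `βZ` are closures of their traces on `Z`. -/
theorem closure_image_preimage_unit {E : Set (StoneCech Z)} (hE : IsClopen E) :
    closure (stoneCechUnit '' (stoneCechUnit ⁻¹' E)) = E := by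
  refine subset_antisymm (closure_minimal (image_preimage_subset _ _) hE.isClosed) fun p hp => ?_
  exact mem_of_isOpen_of_forall_unit hE.isOpen isClosed_closure
    (fun z hz => subset_closure (mem_image_of_mem _ hz)) hp

/-- A bounded continuous function on `Z` extends to `βZ`. -/
theorem exists_stoneCech_extension (h : C(Z, ℝ)) (hh : ∀ z, h z ∈ Icc (-1 : ℝ) 1) :
    ∃ k : C(StoneCech Z, ℝ), ∀ z, k (stoneCechUnit z) = h z := by
  have hc : Continuous fun z => (⟨h z, hh z⟩ : Icc (-1 : ℝ) 1) := h.continuous.subtype_mk _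
  exact ⟨(⟨Subtype.val, continuous_subtype_val⟩ : C(Icc (-1 : ℝ) 1, ℝ)).comp
    ⟨stoneCechExtend hc, continuous_stoneCechExtend hc⟩, fun z =>
    congrArg Subtype.val (stoneCechExtend_unit hc z)⟩

theorem IsFSpace.stoneCech (hZ : IsFSpace Z) : IsFSpace (StoneCech Z) := by
  rw [isFSpace_iff_exists_separating] at hZ ⊢
  intro f
  obtain ⟨h, h1, h0⟩ := hZ (f.comp ⟨stoneCechUnit, continuous_stoneCechUnit⟩)
  obtain ⟨k, hk⟩ := exists_stoneCech_extension (h ⊓ 1 ⊔ -1) fun z => by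
    simp only [ContinuousMap.sup_apply, ContinuousMap.inf_apply, ContinuousMap.one_apply,
      ContinuousMap.neg_apply, mem_Icc, le_sup_right, sup_le_iff, inf_le_right, true_and]
    norm_num
  refine ⟨k, fun p hp => ?_, fun p hp => ?_⟩
  · refine mem_of_isOpen_of_forall_unit (O := {p | 0 < f p}) (E := {p | k p = 1})
      (isOpen_lt continuous_const f.continuous) (isClosed_eq k.continuous continuous_const)
      (fun z hz => ?_) hp
    simp [hk, h1 z hz]
  · refine mem_of_isOpen_of_forall_unit (O := {p | f p < 0}) (E := {p | k p = 0})
      (isOpen_lt f.continuous continuous_const) (isClosed_eq k.continuous continuous_const)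
      (fun z hz => ?_) hp
    simp [hk, h0 z hz]

theorem IsStronglyZeroDim.totallySeparatedSpace_stoneCech (hZ : IsStronglyZeroDim Z) :
    TotallySeparatedSpace (StoneCech Z) := by
  rw [totallySeparatedSpace_iff_exists_isClopen]
  intro p q hpq
  obtain ⟨f, hp, hq, -⟩ := exists_continuous_zero_one_of_isClosed (isClosed_singleton (x := p))
    (isClosed_singleton (x := q)) (by simpa using hpq)
  obtain ⟨D, hD, h0, h1⟩ := hZ ((f + f + f - 1).comp ⟨stoneCechUnit, continuous_stoneCechUnit⟩)
  have hp' : f p = 0 := hp rfl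
  have hq' : f q = 1 := hq rfl
  refine ⟨_, isClopen_closure_image_unit hD, ?_, ?_⟩
  · refine mem_of_isOpen_of_forall_unit (O := {p | f p < 1 / 3})
      (isOpen_lt f.continuous continuous_const) isClosed_closure (fun z hz => ?_)
      (by simp [hp'])
    refine subset_closure (mem_image_of_mem _ (h0 z ?_))
    have : f (stoneCechUnit z) < 1 / 3 := hz
    simp only [ContinuousMap.comp_apply, ContinuousMap.coe_mk, ContinuousMap.sub_apply,
      ContinuousMap.add_apply, ContinuousMap.one_apply]
    linarith
  · rw [compl_closure_image_unit hD]
    refine mem_of_isOpen_of_forall_unit (O := {p | 2 / 3 < f p})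
      (isOpen_lt continuous_const f.continuous) isClosed_closure (fun z hz => ?_)
      (by simp only [mem_ofPred_eq, hq']; norm_num)
    refine subset_closure (mem_image_of_mem _ fun hzD => ?_)
    have h2 : 2 / 3 < f (stoneCechUnit z) := hz
    have h3 := h1 z hzD
    simp only [ContinuousMap.comp_apply, ContinuousMap.coe_mk, ContinuousMap.sub_apply,
      ContinuousMap.add_apply, ContinuousMap.one_apply] at h3
    linarith

end StoneCech

/-! ### Ordinal spaces -/

section OrdSpace

variable {o : Ordinal.{0}}

theorem isOpen_Iic_ordSpace (x : OrdSpace o) : IsOpen (Iic x) := by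
  by_cases hx : IsMax x
  · rw [isMax_iff_eq_top.mp hx, Iic_top]
    exact isOpen_univ
  · obtain ⟨y, hy⟩ := exists_covBy_of_wellFoundedLT hx
    rw [← hy.Iio_eq]
    exact isOpen_Iio

theorem isClopen_Iic_ordSpace (x : OrdSpace o) : IsClopen (Iic x) :=
  ⟨isClosed_Iic, isOpen_Iic_ordSpace x⟩

instance : TotallySeparatedSpace (OrdSpace o) := by
  rw [totallySeparatedSpace_iff_exists_isClopen]
  intro x y hxy
  rcases lt_or_gt_of_ne hxy with h | h
  · exact ⟨Iic x, isClopen_Iic_ordSpace x, mem_Iic.mpr le_rfl, not_le.mpr h⟩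
  · exact ⟨(Iic y)ᶜ, (isClopen_Iic_ordSpace y).compl, not_le.mpr h,
      fun h' => h' (mem_Iic.mpr le_rfl)⟩

theorem cof_toOrdinal (x : OrdSpace o) : x.toOrdinal.cof = Order.cof (Iio x) :=
  (Order.cof_Iio x).symm

theorem toOrdinal_top : (⊤ : OrdSpace o).toOrdinal = o := by
  refine le_antisymm (Order.lt_succ_iff.mp (Ordinal.ToType.toOrd (o := Order.succ o) _).2) ?_
  have h : Ordinal.ToType.mk (o := Order.succ o) ⟨o, Order.lt_succ o⟩ ≤ (⊤ : OrdSpace o) := le_top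
  have h' := (Ordinal.ToType.mk (o := Order.succ o)).symm.monotone h
  rw [OrderIso.symm_apply_apply] at h'
  exact h'

/-- Families of fewer than `cf o` elements below the top element of `o + 1` are bounded below the
top. -/
theorem exists_lt_top_of_mk_lt_cof {ι : Type} (hι : #ι < o.cof) {f : ι → OrdSpace o}
    (hf : ∀ i, f i < ⊤) : ∃ b < ⊤, ∀ i, f i < b := by
  by_contra! h
  have hc : IsCofinal (range fun i => (⟨f i, hf i⟩ : Iio (⊤ : OrdSpace o))) := by
    rintro ⟨b, hb⟩
    obtain ⟨i, hi⟩ := h b hb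
    exact ⟨_, mem_range_self i, hi⟩
  have h1 := (Order.cof_le hc).trans Cardinal.mk_range_le
  rw [← cof_toOrdinal, toOrdinal_top] at h1
  exact absurd hι (not_lt.mpr h1)

theorem exists_covBy_lt_top (ho : ℵ₀ ≤ o.cof) {a : OrdSpace o} (ha : a < ⊤) :
    ∃ b < ⊤, a ⋖ b := by
  obtain ⟨b, hb⟩ := exists_covBy_of_wellFoundedLT (not_isMax_of_lt ha)
  obtain ⟨c, hc, hac⟩ := exists_lt_top_of_mk_lt_cof (o := o) (ι := Unit) (f := fun _ => a)
    (lt_of_lt_of_le (by simp) ho) fun _ => ha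
  exact ⟨b, (hb.ge_of_gt (hac ())).trans_lt hc, hb⟩

/-- Below the top element of `o + 1` there are arbitrarily large limits of countable
cofinality. -/
theorem exists_limit_lt_top (ho : ℵ₀ < o.cof) {a : OrdSpace o} (ha : a < ⊤) :
    ∃ b < ⊤, a < b ∧ Order.cof (Iio b) ≤ ℵ₀ ∧ ∀ c, ¬ c ⋖ b := by
  choose! s hs1 hs2 using fun x : OrdSpace o => exists_covBy_lt_top (a := x) ho.le
  have hlt : ∀ n, s^[n] a < ⊤ := by
    intro n
    induction n with
    | zero => exact ha
    | succ n ih => rw [Function.iterate_succ_apply']; exact hs1 _ ih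
  have hstep : ∀ n, s^[n] a < s^[n + 1] a := by
    intro n
    rw [Function.iterate_succ_apply']
    exact (hs2 _ (hlt n)).lt
  obtain ⟨c, hc, hcn⟩ := exists_lt_top_of_mk_lt_cof (by simpa using ho) hlt
  let B : Set (OrdSpace o) := {b | ∀ n, s^[n] a < b}
  have hB : B.Nonempty := ⟨c, hcn⟩
  have hmem : wellFounded_lt.min B hB ∈ B := wellFounded_lt.min_mem B hB
  have hex : ∀ y < wellFounded_lt.min B hB, ∃ n, y ≤ s^[n] a := by
    intro y hy
    by_contra! h
    exact wellFounded_lt.not_lt_min B h hy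
  refine ⟨_, (wellFounded_lt.min_le (show c ∈ B from hcn)).trans_lt hc, hmem 0, ?_,
    fun y hy => ?_⟩
  · refine (Order.cof_le (s := range fun n => ⟨s^[n] a, hmem n⟩) ?_).trans
      ((countable_range _).le_aleph0)
    rintro ⟨y, hy⟩
    obtain ⟨n, hn⟩ := hex y hy
    exact ⟨_, mem_range_self n, hn⟩
  · obtain ⟨n, hn⟩ := hex y hy.lt
    exact hy.2 (hn.trans_lt (hstep n)) (hmem (n + 1))

end OrdSpace

/-! ### The space `(ω₂ + 1)_δ` -/

noncomputable instance : LinearOrder X := inferInstanceAs (LinearOrder (OrdSpace (ω_ 2)))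

instance : WellFoundedLT X := inferInstanceAs (WellFoundedLT (OrdSpace (ω_ 2)))

noncomputable instance : OrderTop X := inferInstanceAs (OrderTop (OrdSpace (ω_ 2)))

theorem cof_omega_two : (ω_ 2).cof = ℵ_ 2 := by
  rw [← Cardinal.ord_aleph]
  have := Cardinal.isRegular_aleph_add_one 1
  rw [one_add_one_eq_two] at this
  exact this.cof_ord

theorem cof_omega_one : (ω_ 1).cof = ℵ_ 1 := by
  rw [← Cardinal.ord_aleph]
  exact Cardinal.isRegular_aleph_one.cof_ord

theorem mk_ordSpace_omega_one : #(OrdSpace (ω_ 1)) = ℵ_ 1 := by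
  have : #(OrdSpace (ω_ 1)) = (Order.succ (ω_ 1)).card := Cardinal.mk_toType _
  rw [this, Order.succ_eq_add_one, Ordinal.card_add_one, Ordinal.card_omega,
    Cardinal.add_one_eq Cardinal.aleph0_lt_aleph_one.le]

theorem aleph_one_lt_aleph_two : ℵ_ 1 < ℵ_ 2 :=
  Cardinal.aleph_lt_aleph.mpr (by exact_mod_cast Nat.one_lt_two)

theorem aleph0_lt_aleph_two : ℵ₀ < ℵ_ 2 :=
  Cardinal.aleph0_lt_aleph_one.trans aleph_one_lt_aleph_two

theorem aleph0_lt_cof_omega_two : ℵ₀ < (ω_ 2).cof :=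
  cof_omega_two ▸ aleph0_lt_aleph_two

theorem isOpen_of_isGδ {s : Set (OrdSpace (ω_ 2))} (hs : IsGδ s) : IsOpen (X := X) s :=
  TopologicalSpace.isOpen_generateFrom_of_mem hs

theorem exists_isGδ_subset {U : Set X} (hU : IsOpen U) {x : X} (hx : x ∈ U) :
    ∃ H : Set (OrdSpace (ω_ 2)), IsGδ H ∧ x ∈ H ∧ H ⊆ U := by
  have hb := TopologicalSpace.isTopologicalBasis_of_subbasis (α := X) rfl
  obtain ⟨_, ⟨f, ⟨hf, hfs⟩, rfl⟩, hxH, hHU⟩ := hb.exists_subset_of_mem_open hx hU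
  exact ⟨⋂₀ f, IsGδ.sInter hfs hf.countable, hxH, hHU⟩

theorem isPSpace_X : IsPSpace X := by
  intro S hS
  rw [isOpen_iff_forall_mem_open]
  intro x hx
  choose H hH hxH hHS using fun n => exists_isGδ_subset (hS n) (mem_iInter.mp hx n)
  exact ⟨⋂ n, H n, iInter_mono hHS, isOpen_of_isGδ (IsGδ.iInter hH), mem_iInter.mpr hxH⟩

instance : T1Space X := ⟨fun x => ⟨isOpen_of_isGδ
  (isClosed_singleton (X := OrdSpace (ω_ 2)) (x := x)).isOpen_compl.isGδ⟩⟩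

/-- Every neighbourhood of a point `x` of `(ω₂ + 1)_δ` contains a set of the form
`⋂ z ∈ s, (z, x]` with `s` countable. -/
theorem exists_countable_Ioc_subset {U : Set X} (hU : IsOpen U) {x : X} (hx : x ∈ U) :
    ∃ s : Set X, s.Countable ∧ s ⊆ Iio x ∧ ∀ y ≤ x, (∀ z ∈ s, z < y) → y ∈ U := by
  by_cases hmin : ∃ l : OrdSpace (ω_ 2), l < x
  · obtain ⟨H, hH, hxH, hHU⟩ := exists_isGδ_subset hU hx
    obtain ⟨O, hO, rfl⟩ := isGδ_iff_eq_iInter_nat.mp hH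
    choose l hl hlO using fun n =>
      exists_Ioc_subset_of_mem_nhds ((hO n).mem_nhds (mem_iInter.mp hxH n)) hmin
    refine ⟨range l, countable_range l, range_subset_iff.mpr hl, fun y hy hyl => hHU ?_⟩
    exact mem_iInter.mpr fun n => hlO n ⟨hyl _ (mem_range_self n), hy⟩
  · push Not at hmin
    refine ⟨∅, countable_empty, empty_subset _, fun y hy _ => ?_⟩
    rwa [le_antisymm hy (not_lt.mp (hmin y))]

theorem exists_Ioi_subset_of_top_mem {U : Set X} (hU : IsOpen U) (h : ⊤ ∈ U) :
    ∃ a < ⊤, Ioi a ⊆ U := by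
  obtain ⟨s, hs, hsx, hsU⟩ := exists_countable_Ioc_subset hU h
  obtain ⟨b, hb, hsb⟩ := exists_lt_top_of_mk_lt_cof (o := ω_ 2) (ι := s) (f := fun z => z.1)
    (hs.le_aleph0.trans_lt aleph0_lt_cof_omega_two) fun z => hsx z.2
  exact ⟨b, hb, fun y hy => hsU y le_top fun z hz => (hsb ⟨z, hz⟩).trans hy⟩

theorem isLindelof_univ_X : IsLindelof (univ : Set X) := by
  refine isLindelof_of_countable_subcover fun {ι} O hO hcov => ?_
  have key : ∀ x : X, ∃ t : Set ι, t.Countable ∧ Iic x ⊆ ⋃ i ∈ t, O i := by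
    intro x
    induction x using WellFoundedLT.induction with
    | ind x ih =>
      choose! t ht htO using ih
      obtain ⟨i, hi⟩ := mem_iUnion.mp (hcov (mem_univ x))
      obtain ⟨s, hs, hsx, hsU⟩ := exists_countable_Ioc_subset (hO i) hi
      refine ⟨insert i (⋃ z ∈ s, t z),
        (hs.biUnion fun z hz => ht z (hsx hz)).insert i, fun y hy => ?_⟩
      by_cases h : ∀ z ∈ s, z < y
      · exact mem_biUnion (mem_insert _ _) (hsU y hy h)
      · push Not at h
        obtain ⟨z, hz, hyz⟩ := h
        obtain ⟨j, hj, hyj⟩ := mem_iUnion₂.mp (htO z (hsx hz) hyz)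
        exact mem_biUnion (mem_insert_of_mem _ (mem_biUnion hz hj)) hyj
  obtain ⟨t, ht, htO⟩ := key ⊤
  exact ⟨t, ht, fun x _ => htO (mem_Iic.mpr le_top)⟩

theorem notMem_L_iff {x : X} : x ∉ L ↔ Order.cof (Iio x) ≤ ℵ₀ := by
  have h : Order.cof (Iio x) = (OrdSpace.toOrdinal (o := ω_ 2) x).cof :=
    (cof_toOrdinal (o := ω_ 2) x).symm
  rw [h, ← Cardinal.lt_aleph_one_iff]
  exact not_le (a := ℵ₁) (b := (OrdSpace.toOrdinal (o := ω_ 2) x).cof)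

theorem isOpen_singleton_of_notMem_L {x : X} (hx : x ∉ L) : IsOpen {x} := by
  obtain ⟨s, hs, hsc⟩ := Order.exists_cof_eq (Iio x)
  have hsc' : s.Countable := by
    rw [← Cardinal.le_aleph0_iff_set_countable, hsc]
    exact notMem_L_iff.mp hx
  have heq : ({x} : Set X) = Iic x ∩ ⋂ z ∈ s, Ioi z.1 := by
    ext y
    simp only [mem_singleton_iff, mem_inter_iff, mem_Iic, mem_iInter, mem_Ioi]
    refine ⟨?_, fun ⟨hyx, hy⟩ => ?_⟩
    · rintro rfl
      exact ⟨le_rfl, fun z _ => z.2⟩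
    · refine hyx.eq_of_not_lt fun hlt => ?_
      obtain ⟨z, hz, hyz⟩ := hs ⟨y, hlt⟩
      exact absurd (hy z hz) (not_lt.mpr hyz)
  rw [heq]
  refine isOpen_of_isGδ (IsGδ.inter (isOpen_Iic_ordSpace (o := ω_ 2) x).isGδ ?_)
  exact IsGδ.biInter hsc' fun z _ => (isOpen_Ioi (α := OrdSpace (ω_ 2)) (a := z.1)).isGδ

theorem isOpen_of_subset_compl_L {A : Set X} (hA : A ⊆ Lᶜ) : IsOpen A := by
  rw [← biUnion_of_singleton A]
  exact isOpen_biUnion fun x hx => isOpen_singleton_of_notMem_L (hA hx)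

theorem isClosed_L : IsClosed L := ⟨isOpen_of_subset_compl_L subset_rfl⟩

theorem isClopen_of_countable {A : Set X} (hA : A.Countable) (hAL : A ⊆ Lᶜ) : IsClopen A :=
  ⟨isPSpace_X.isClosed_of_countable hA, isOpen_of_subset_compl_L hAL⟩

/-- A closed set disjoint from `L` is Lindelöf and discrete. -/
theorem countable_of_isClosed {A : Set X} (hA : IsClosed A) (hAL : A ⊆ Lᶜ) : A.Countable := by
  have hl : IsLindelof A := isLindelof_univ_X.of_isClosed_subset hA (subset_univ A)
  obtain ⟨r, hr, hAr⟩ := hl.elim_countable_subcover (fun x : A => {x.1})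
    (fun x => isOpen_singleton_of_notMem_L (hAL x.2)) fun x hx => mem_iUnion.mpr ⟨⟨x, hx⟩, rfl⟩
  exact (hr.biUnion fun _ _ => countable_singleton _).mono hAr

/-! ### Cofinal families of countable sets -/

/-- On every set of size `κ`, there is a family of `κ` many countable sets that is cofinal among
the countable sets. -/
def HasCountableCofinal (κ : Cardinal.{0}) : Prop :=
  ∀ α : Type, #α ≤ κ → ∃ 𝒜 : Set (Set α), #𝒜 ≤ κ ∧ (∀ A ∈ 𝒜, A.Countable) ∧
    ∀ B : Set α, B.Countable → ∃ A ∈ 𝒜, B ⊆ A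

theorem hasCountableCofinal_aleph0 : HasCountableCofinal ℵ₀ := by
  intro α hα
  refine ⟨{univ}, by simp, ?_, fun B _ => ⟨univ, rfl, subset_univ B⟩⟩
  rintro _ rfl
  exact countable_univ_iff.mpr (Cardinal.mk_le_aleph0_iff.mp hα)

/-- A countable subset of a set of size `κ⁺` is contained in one of `κ⁺` many initial segments, each
of size at most `κ`. -/
theorem HasCountableCofinal.succ {κ : Cardinal.{0}} (hκ : ℵ₀ ≤ κ) (h : HasCountableCofinal κ) :
    HasCountableCofinal (Order.succ κ) := by
  intro α hα
  let W := (Order.succ κ).ord.ToType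
  have hW : #W = Order.succ κ := by simp [W]
  obtain ⟨e⟩ : Nonempty (α ↪ W) := by rwa [← Cardinal.le_def, hW]
  have hseg : ∀ w : W, #{a : α // e a < w} ≤ κ := by
    intro w
    rw [← Order.lt_succ_iff]
    refine lt_of_le_of_lt ?_ (hW ▸ Cardinal.mk_Iio_lt w (by simp [W]))
    exact Cardinal.mk_le_of_injective (f := fun a => (⟨e a.1, a.2⟩ : Iio w))
      fun a b hab => Subtype.ext (e.injective (congrArg Subtype.val hab))
  choose 𝒜 h𝒜 hcount hcof using fun w => h _ (hseg w)
  refine ⟨⋃ w, (fun A => Subtype.val '' A) '' 𝒜 w, ?_, ?_, fun B hB => ?_⟩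
  · refine (Cardinal.mk_iUnion_le_sum_mk).trans ((Cardinal.sum_le_sum _ (fun _ => κ) fun w =>
      Cardinal.mk_image_le.trans (h𝒜 w)).trans ?_)
    rw [Cardinal.sum_const', hW]
    exact (Cardinal.mul_eq_left (hκ.trans (Order.le_succ κ)) (Order.le_succ κ)
      (Cardinal.aleph0_pos.trans_le hκ).ne').le
  · intro A hA
    obtain ⟨w, A', hA', rfl⟩ := mem_iUnion.mp hA
    exact (hcount w A' hA').image _
  · have hnc : ¬ IsCofinal (e '' B) := by
      intro hc
      have h1 := Order.cof_le hc
      rw [Ordinal.cof_toType, (Cardinal.isRegular_succ hκ).cof_ord] at h1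
      have h2 := h1.trans (hB.image e).le_aleph0
      exact absurd (h2.trans hκ) (not_le.mpr (Order.lt_succ κ))
    obtain ⟨w, hw⟩ : ∃ w, ∀ y ∈ e '' B, y < w := by
      simpa [IsCofinal] using hnc
    obtain ⟨A, hA, hBA⟩ := hcof w (Subtype.val ⁻¹' B)
      (hB.preimage Subtype.val_injective)
    refine ⟨_, mem_iUnion.mpr ⟨w, mem_image_of_mem _ hA⟩, fun b hb => ?_⟩
    exact ⟨⟨b, hw _ (mem_image_of_mem e hb)⟩, hBA hb, rfl⟩

theorem hasCountableCofinal_aleph_two : HasCountableCofinal (ℵ_ 2) := by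
  have h1 := hasCountableCofinal_aleph0.succ le_rfl
  rw [Cardinal.succ_aleph0] at h1
  have h2 := h1.succ Cardinal.aleph0_lt_aleph_one.le
  have h3 : Order.succ (ℵ_ 1) = ℵ_ 2 := by rw [Cardinal.succ_aleph, one_add_one_eq_two]
  rwa [h3] at h2

theorem mk_compl_L : #(Lᶜ : Set X) = ℵ_ 2 := by
  apply le_antisymm
  · refine (Cardinal.mk_set_le _).trans ?_
    have : #X = (Order.succ (ω_ 2)).card := Cardinal.mk_toType _
    rw [this, Order.succ_eq_add_one, Ordinal.card_add_one, Ordinal.card_omega,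
      Cardinal.add_one_eq aleph0_lt_aleph_two.le]
  · -- the limits of countable cofinality are cofinal in `ω₂`
    have hc : IsCofinal {x : Iio (⊤ : OrdSpace (ω_ 2)) | (x.1 : X) ∉ L} := by
      rintro ⟨a, ha⟩
      obtain ⟨b, hb, hab, hcof, -⟩ := exists_limit_lt_top aleph0_lt_cof_omega_two ha
      exact ⟨⟨b, hb⟩, notMem_L_iff.mpr hcof, hab.le⟩
    have h1 := Order.cof_le hc
    rw [← cof_toOrdinal, toOrdinal_top, cof_omega_two] at h1
    refine h1.trans (Cardinal.mk_le_of_injective (f := fun x => (⟨x.1.1, x.2⟩ : (Lᶜ : Set X))) ?_)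
    intro x y hxy
    exact Subtype.ext (Subtype.ext (Subtype.mk.inj hxy))

theorem exists_cofinal_family : ∃ 𝒜 : Set (Set X), #𝒜 = ℵ_ 2 ∧
    (∀ A ∈ 𝒜, A.Countable ∧ A.Infinite ∧ A ⊆ Lᶜ) ∧
    ∀ B : Set X, B.Countable → B ⊆ Lᶜ → ∃ A ∈ 𝒜, B ⊆ A := by
  obtain ⟨𝒜, h𝒜, hcount, hcof⟩ := hasCountableCofinal_aleph_two (Lᶜ : Set X) mk_compl_L.le
  have : Infinite (Lᶜ : Set X) := by
    rw [Cardinal.infinite_iff, mk_compl_L]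
    exact aleph0_lt_aleph_two.le
  -- adding a fixed countably infinite set makes all members infinite
  let A₀ : Set (Lᶜ : Set X) := range (Infinite.natEmbedding (Lᶜ : Set X))
  have hA₀ : A₀.Infinite := infinite_range_of_injective (Infinite.natEmbedding _).injective
  let ℬ : Set (Set X) := (fun A => Subtype.val '' (A ∪ A₀)) '' 𝒜
  have h1 : ∀ A ∈ ℬ, A.Countable ∧ A.Infinite ∧ A ⊆ Lᶜ := by
    rintro _ ⟨A, hA, rfl⟩
    refine ⟨((hcount A hA).union (countable_range _)).image _,
      (hA₀.mono subset_union_right).image Subtype.val_injective.injOn, ?_⟩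
    rintro _ ⟨x, -, rfl⟩
    exact x.2
  have h2 : ∀ B : Set X, B.Countable → B ⊆ Lᶜ → ∃ A ∈ ℬ, B ⊆ A := by
    intro B hB hBL
    obtain ⟨A, hA, hBA⟩ := hcof (Subtype.val ⁻¹' B) (hB.preimage Subtype.val_injective)
    exact ⟨_, mem_image_of_mem _ hA, fun b hb => ⟨⟨b, hBL hb⟩, Or.inl (hBA hb), rfl⟩⟩
  refine ⟨ℬ, le_antisymm (Cardinal.mk_image_le.trans h𝒜) ?_, h1, h2⟩
  by_contra! hlt
  have hsub : Lᶜ ⊆ ⋃₀ ℬ := by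
    intro x hx
    obtain ⟨A, hA, hxA⟩ := h2 {x} (countable_singleton x) (singleton_subset_iff.mpr hx)
    exact ⟨A, hA, hxA rfl⟩
  have h3 : #(⋃₀ ℬ) ≤ #ℬ * ℵ₀ := by
    refine (Cardinal.mk_sUnion_le ℬ).trans ?_
    gcongr
    exact ciSup_le' fun A => (h1 A.1 A.2).1.le_aleph0
  have h4 : ℵ_ 2 < ℵ_ 2 := calc
    ℵ_ 2 = #(Lᶜ : Set X) := mk_compl_L.symm
    _ ≤ #ℬ * ℵ₀ := (Cardinal.mk_le_mk_of_subset hsub).trans h3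
    _ < ℵ_ 2 := Cardinal.mul_lt_of_lt aleph0_lt_aleph_two.le hlt aleph0_lt_aleph_two
  exact lt_irrefl _ h4

/-! ### The remainder of the product of `ℕ` with a compact space -/

section Remainder

variable {H : Type} [TopologicalSpace H]

theorem isClopen_fst_lt (n : ℕ) : IsClopen {p : ℕ × H | p.1 < n} :=
  (isClopen_discrete (Iio n)).preimage continuous_fst

variable [CompactSpace H]

theorem closure_image_fst_lt_subset (n : ℕ) :
    closure (stoneCechUnit '' {p : ℕ × H | p.1 < n}) ⊆ range stoneCechUnit := by
  have hc : IsCompact {p : ℕ × H | p.1 < n} := by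
    have : {p : ℕ × H | p.1 < n} = Iio n ×ˢ univ := by ext; simp
    rw [this]
    exact (finite_Iio n).isCompact.prod isCompact_univ
  rw [(hc.image continuous_stoneCechUnit).isClosed.closure_eq]
  exact image_subset_range _ _

/-- A point of the remainder is in the closure of `[n, ∞) × H`, for all `n`. -/
theorem mem_compl_closure_of_remainder (p : Remainder (ℕ × H)) (n : ℕ) :
    p.1 ∈ (closure (stoneCechUnit '' {q : ℕ × H | q.1 < n}))ᶜ := fun hp =>
  p.2 (closure_image_fst_lt_subset n hp)

theorem isOpen_range_unit_nat_prod :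
    IsOpen (range (stoneCechUnit : ℕ × H → StoneCech (ℕ × H))) := by
  rw [isOpen_iff_forall_mem_open]
  rintro _ ⟨p, rfl⟩
  exact ⟨_, closure_image_fst_lt_subset (p.1 + 1),
    (isClopen_closure_image_unit (isClopen_fst_lt _)).isOpen,
    subset_closure (mem_image_of_mem _ (Nat.lt_succ_self p.1))⟩

theorem isClosedEmbedding_remainder_val :
    IsClosedEmbedding (Subtype.val : Remainder (ℕ × H) → StoneCech (ℕ × H)) :=
  IsClosed.isClosedEmbedding_subtypeVal isOpen_range_unit_nat_prod.isClosed_compl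

instance : CompactSpace (Remainder (ℕ × H)) :=
  isClosedEmbedding_remainder_val.compactSpace

/-- The remainder of `ℕ × H` is an `F`-space, without any condition on the compact space `H`: if `F`
extends `f` to `β(ℕ × H)`, then the truncations of `(n + 1) F` on `{n} × H` define a function that
separates the signs of `f` on the remainder. -/
theorem isFSpace_remainder_nat_prod : IsFSpace (Remainder (ℕ × H)) := by
  rw [isFSpace_iff_exists_separating]
  intro f
  obtain ⟨F, hF⟩ := ContinuousMap.exists_extension isClosedEmbedding_remainder_val f
  have hF' : ∀ p : Remainder (ℕ × H), F p.1 = f p := fun p => DFunLike.congr_fun hF p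
  let g : C(ℕ × H, ℝ) := ⟨fun p => max 0 (min 1 ((p.1 + 1) * F (stoneCechUnit p))), by
    have h1 : Continuous fun p : ℕ × H => (p.1 : ℝ) :=
      continuous_of_discreteTopology.comp continuous_fst
    have h2 : Continuous fun p : ℕ × H => F (stoneCechUnit p) :=
      F.continuous.comp continuous_stoneCechUnit
    exact continuous_const.max (continuous_const.min ((h1.add continuous_const).mul h2))⟩
  have hg : ∀ p, g p = max 0 (min 1 ((p.1 + 1) * F (stoneCechUnit p))) := fun _ => rfl
  obtain ⟨k, hk⟩ := exists_stoneCech_extension g fun p => by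
    rw [hg, mem_Icc]
    exact ⟨le_max_of_le_left (by norm_num), max_le zero_le_one (min_le_left _ _)⟩
  -- near a point of the remainder, only the points `(n, x)` of `ℕ × H` with `n ≥ N` matter
  have key : ∀ (p : Remainder (ℕ × H)) (c : ℝ) (N : ℕ) (O : Set (StoneCech (ℕ × H))), IsOpen O →
      p.1 ∈ O → (∀ q : ℕ × H, stoneCechUnit q ∈ O → N ≤ q.1 → g q = c) → k p.1 = c := by
    intro p c N O hO hp hq
    refine mem_of_isOpen_of_forall_unit (E := {p | k p = c})
      (hO.inter (isClopen_closure_image_unit (isClopen_fst_lt N)).compl.isOpen)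
      (isClosed_eq k.continuous continuous_const) ?_ ⟨hp, mem_compl_closure_of_remainder p N⟩
    rintro q ⟨hq1, hq2⟩
    rw [mem_compl_iff, unit_mem_closure_image_iff (isClopen_fst_lt N)] at hq2
    exact (hk q).trans (hq q hq1 (not_lt.mp hq2))
  refine ⟨k.comp ⟨Subtype.val, continuous_subtype_val⟩, fun p hp => ?_, fun p hp => ?_⟩
  · obtain ⟨N, hN⟩ := exists_nat_one_div_lt hp
    refine key p 1 N {q | 1 / ((N : ℝ) + 1) < F q} (isOpen_lt continuous_const F.continuous)
      (by rw [← hF' p] at hN; exact hN) fun q hq hNq => ?_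
    have hq' : 1 / ((N : ℝ) + 1) < F (stoneCechUnit q) := hq
    have h1 : 1 ≤ ((q.1 : ℝ) + 1) * F (stoneCechUnit q) := by
      rw [div_lt_iff₀ (by positivity)] at hq'
      have h2 : (N : ℝ) ≤ q.1 := by exact_mod_cast hNq
      have h3 : 0 ≤ F (stoneCechUnit q) := by
        by_contra! h
        have := mul_nonpos_of_nonpos_of_nonneg h.le (by positivity : (0 : ℝ) ≤ N + 1)
        linarith
      nlinarith
    rw [hg, min_eq_left h1, max_eq_right zero_le_one]
  · refine key p 0 0 {q | F q < 0} (isOpen_lt F.continuous continuous_const)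
      (by rw [← hF' p] at hp; exact hp) fun q hq _ => ?_
    have hq' : F (stoneCechUnit q) < 0 := hq
    rw [hg, max_eq_left]
    exact (min_le_right _ _).trans (mul_nonpos_of_nonneg_of_nonpos (by positivity) hq'.le)

/-- Every point of `H` is the image of a point of the remainder under the extension of the
projection `ℕ × H → H`. -/
theorem exists_remainder_extend_snd_eq [T2Space H] (x : H) : ∃ p : Remainder (ℕ × H),
    stoneCechExtend (continuous_snd : Continuous (Prod.snd : ℕ × H → H)) p.1 = x := by
  let E : Set (StoneCech (ℕ × H)) := closure (range fun n : ℕ => stoneCechUnit (n, x))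
  have hE : ∀ p ∈ E,
      stoneCechExtend (continuous_snd : Continuous (Prod.snd : ℕ × H → H)) p = x := by
    refine closure_minimal (t := {p |
      stoneCechExtend (continuous_snd : Continuous (Prod.snd : ℕ × H → H)) p = x}) ?_
      (isClosed_eq (continuous_stoneCechExtend _) continuous_const)
    rintro _ ⟨n, rfl⟩
    exact stoneCechExtend_unit _ _
  by_contra! h
  -- otherwise the increasing open sets `cl ([0, n) × H)` cover the compact set `E`
  have hcov : E ⊆ ⋃ n, closure (stoneCechUnit '' {p : ℕ × H | p.1 < n}) := by
    intro p hp
    by_cases hpr : p ∈ range stoneCechUnit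
    · obtain ⟨q, rfl⟩ := hpr
      exact mem_iUnion.mpr ⟨q.1 + 1, subset_closure (mem_image_of_mem _ (Nat.lt_succ_self q.1))⟩
    · exact absurd (hE p hp) (h ⟨p, hpr⟩)
  obtain ⟨n, hn⟩ := isClosed_closure.isCompact.elim_directed_cover _
    (fun n => (isClopen_closure_image_unit (isClopen_fst_lt n)).isOpen) hcov
    (Monotone.directed_le fun m n hmn =>
      closure_mono (image_mono fun p hp => lt_of_lt_of_le hp hmn))
  have hmem : (stoneCechUnit (n, x) : StoneCech (ℕ × H)) ∈ E := subset_closure (mem_range_self n)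
  have := (unit_mem_closure_image_iff (isClopen_fst_lt n)).mp (hn hmem)
  exact lt_irrefl n this

end Remainder

instance : TotallySeparatedSpace (StoneCech ℕ) :=
  have := CompactT2.Projective.extremallyDisconnected (StoneCech.projective (X := ℕ))
  inferInstance

theorem nonempty_remainder_nat : Nonempty (Remainder ℕ) := by
  by_contra! h
  have hcov : (univ : Set (StoneCech ℕ)) ⊆ ⋃ n, closure (stoneCechUnit '' Iio n) := by
    intro p _
    by_cases hpr : p ∈ range stoneCechUnit
    · obtain ⟨q, rfl⟩ := hpr
      exact mem_iUnion.mpr ⟨q + 1, subset_closure (mem_image_of_mem _ (Nat.lt_succ_self q))⟩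
    · exact h.elim ⟨p, hpr⟩
  obtain ⟨n, hn⟩ := isCompact_univ.elim_directed_cover _
    (fun n => (isClopen_closure_image_unit (isClopen_discrete (Iio n))).isOpen) hcov
    (Monotone.directed_le fun m n hmn => closure_mono (image_mono (Iio_subset_Iio hmn)))
  have := (unit_mem_closure_image_iff (isClopen_discrete (Iio n))).mp
    (hn (mem_univ (stoneCechUnit n)))
  exact lt_irrefl n this

/-! ### The space `Ω` -/

instance : TotallySeparatedSpace G := by
  rw [totallySeparatedSpace_iff_exists_isClopen]
  intro x y hxy
  obtain ⟨D, hD, hx, hy⟩ := exists_isClopen_of_totally_separated (injective_toProd.ne hxy)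
  exact ⟨toProd ⁻¹' D, hD.preimage continuous_toProd, hx, hy⟩

theorem continuous_piStar : Continuous piStar :=
  (continuous_stoneCechExtend _).comp continuous_subtype_val

instance : TotallySeparatedSpace (StoneCech Y) :=
  (isPSpace_of_discreteTopology.isStronglyZeroDim_prod
    isStronglyZeroDim_of_compactSpace).totallySeparatedSpace_stoneCech

instance : TotallySeparatedSpace (Remainder Y) := inferInstance

namespace Omega

/-- The canonical map `Y* → Ω`. -/
noncomputable def inl : C(Remainder Y, Omega) :=
  ⟨Adjunction.left _ _, continuous_quot_mk.comp continuous_inl⟩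

/-- The canonical map `βℕ → Ω`. -/
noncomputable def inr : C(StoneCech ℕ, Omega) :=
  ⟨Adjunction.right _ _, continuous_quot_mk.comp continuous_inr⟩

variable {Z : Type*} [TopologicalSpace Z]

theorem cases (p : Omega) : (∃ y, p = inl y) ∨ ∃ z, p = inr z := by
  obtain ⟨y | z, rfl⟩ := Quot.exists_rep p
  · exact Or.inl ⟨y, rfl⟩
  · exact Or.inr ⟨z, rfl⟩

theorem inl_eq_inr_restr (y : preBetaNat) : inl y.1 = inr (restr y) :=
  Quot.sound ⟨y, rfl, rfl⟩

/-- The continuous map on `Ω` that is given by `h` on `Y*` and by `k` on `βℕ`. -/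
noncomputable def glue (h : C(Remainder Y, Z)) (k : C(StoneCech ℕ, Z))
    (hk : ∀ y : preBetaNat, h y.1 = k (restr y)) : C(Omega, Z) :=
  ⟨Quot.lift (Sum.elim h k) (by rintro _ _ ⟨y, rfl, rfl⟩; exact hk y),
    continuous_quot_lift _ (h.continuous.sumElim k.continuous)⟩

section glue

variable (h : C(Remainder Y, Z)) (k : C(StoneCech ℕ, Z))
  (hk : ∀ y : preBetaNat, h y.1 = k (restr y))

@[simp] theorem glue_inl (y : Remainder Y) : glue h k hk (inl y) = h y := rfl

end glue

/-- The map `Ω → G` that extends `π*`. -/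
noncomputable def toG : C(Omega, G) :=
  glue ⟨piStar, continuous_piStar⟩ ⟨Adjunction.right _ _, continuous_quot_mk.comp continuous_inr⟩
    fun y => (right_restr y).symm

/-- The retraction of `Ω` onto `βℕ`. -/
noncomputable def ret : C(Omega, StoneCech ℕ) := ⟨fun p => (toProd (toG p)).1,
  continuous_fst.comp (continuous_toProd.comp toG.continuous)⟩

/-- The second coordinate `Ω → G → ω₁ + 1`. It takes the value `ω₁` on `βℕ` only. -/
noncomputable def level : C(Omega, OrdSpace (ω_ 1)) := ⟨fun p => (toProd (toG p)).2,
  continuous_snd.comp (continuous_toProd.comp toG.continuous)⟩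

@[simp] theorem level_inr (z : StoneCech ℕ) : level (inr z) = ⊤ := rfl

@[simp] theorem ret_inr (z : StoneCech ℕ) : ret (inr z) = z := rfl

theorem inr_ret_of_level_eq_top {p : Omega} (hp : level p = ⊤) : inr (ret p) = p := by
  obtain ⟨y, rfl⟩ | ⟨z, rfl⟩ := cases p
  · have h : piStar y = Adjunction.right _ _ (ret (inl y)) :=
      injective_toProd (Prod.ext rfl hp)
    have hy : y ∈ preBetaNat := ⟨_, h.symm⟩
    rw [inl_eq_inr_restr ⟨y, hy⟩, ret_inr]
  · rw [ret_inr]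

theorem mem_V_iff {α : OrdSpace (ω_ 1)} (hα : α < ⊤) {p : Omega} : p ∈ V α ↔ level p ≤ α := by
  constructor
  · rintro ⟨y, ⟨q, hq, hqy⟩, rfl⟩
    change (toProd (piStar y)).2 ≤ α
    rw [← hqy]
    exact hq
  · intro hp
    obtain ⟨y, rfl⟩ | ⟨z, rfl⟩ := cases p
    · refine ⟨y, ?_, rfl⟩
      have hp' : (toProd (piStar y)).2 ≤ α := hp
      change piStar y ∈ segG α
      obtain ⟨q | z, hq⟩ := Quot.exists_rep (piStar y)
      · rw [← hq] at hp' ⊢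
        exact ⟨q, hp', rfl⟩
      · rw [← hq] at hp'
        exact absurd hα (not_lt.mpr hp')
    · exact absurd hα (not_lt.mpr hp)

theorem isClopen_level_le (α : OrdSpace (ω_ 1)) : IsClopen {p : Omega | level p ≤ α} :=
  (isClopen_Iic_ordSpace α).preimage level.continuous

theorem isClopen_V {α : OrdSpace (ω_ 1)} (hα : α < ⊤) : IsClopen (V α) := by
  convert isClopen_level_le α using 1
  ext p
  exact mem_V_iff hα

theorem exists_level_eq (α : OrdSpace (ω_ 1)) : ∃ p : Omega, level p = α := by
  obtain ⟨u⟩ := nonempty_remainder_nat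
  obtain ⟨y, hy⟩ := exists_remainder_extend_snd_eq (H := G) (Adjunction.left _ _ (u, α))
  refine ⟨inl y, ?_⟩
  have : toG (inl y) = Adjunction.left _ _ (u, α) := hy
  change (toProd (toG (inl y))).2 = α
  rw [this]
  rfl

theorem inr_mem_closure_C (z : StoneCech ℕ) : inr z ∈ closure C := by
  have h := image_closure_subset_closure_image (s := range stoneCechUnit) inr.continuous
  rw [(denseRange_stoneCechUnit (α := ℕ)).closure_range, ← range_comp] at h
  exact h (mem_image_of_mem _ (mem_univ z))

/-- Points of `Ω` with different images in `G` are separated by a clopen set of `G`; two points of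
`Y*` with the same image outside `βℕ` are separated within some `V α`. -/
instance : TotallySeparatedSpace Omega := by
  rw [totallySeparatedSpace_iff_exists_isClopen]
  intro p q hpq
  by_cases hG : toG p = toG q
  · have hlev : level p = level q := congrArg (fun g => (toProd g).2) hG
    have hret : ret p = ret q := congrArg (fun g => (toProd g).1) hG
    have htop : level p ≠ ⊤ := fun h => hpq <| by
      rw [← inr_ret_of_level_eq_top h, hret, inr_ret_of_level_eq_top (hlev ▸ h)]
    obtain ⟨y, rfl⟩ | ⟨z, rfl⟩ := cases p
    swap
    · exact absurd (level_inr z) htop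
    obtain ⟨y', rfl⟩ | ⟨z, rfl⟩ := cases q
    swap
    · exact absurd (hlev.trans (level_inr z)) htop
    obtain ⟨D, hD, hy, hy'⟩ := exists_isClopen_of_totally_separated
      (show y ≠ y' from fun h => hpq (congrArg inl h))
    have hD' : IsClopen (D ∩ {x | level (inl x) ≤ level (inl y)}) :=
      hD.inter ((isClopen_level_le _).preimage inl.continuous)
    let χ : C(Omega, Bool) := glue ⟨_, (continuous_boolIndicator_iff_isClopen _).mpr hD'⟩
      (ContinuousMap.const _ false) (by
        rintro ⟨x, hx⟩
        have hx' : level (inl x) = ⊤ := by rw [inl_eq_inr_restr ⟨x, hx⟩, level_inr]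
        refine (notMem_iff_boolIndicator _ _).mp fun h => htop ?_
        exact top_le_iff.mp (hx' ▸ h.2))
    refine ⟨χ ⁻¹' {true}, (isClopen_discrete _).preimage χ.continuous, ?_, ?_⟩
    · exact (mem_iff_boolIndicator _ _).mp ⟨hy, le_refl (level (inl y))⟩
    · intro h
      exact hy' ((mem_iff_boolIndicator (D ∩ {x | level (inl x) ≤ level (inl y)}) y').mpr h).1
  · obtain ⟨D, hD, hp, hq⟩ := exists_isClopen_of_totally_separated hG
    exact ⟨toG ⁻¹' D, hD.preimage toG.continuous, hp, hq⟩

instance : T2Space Omega := inferInstance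

/-- `βℕ` is a `P`-set in `Ω`: a countable union of closed sets disjoint from `βℕ` is contained
in some `V α`. -/
theorem exists_level_le_of_isClosed {S : ℕ → Set Omega} (hS : ∀ n, IsClosed (S n))
    (htop : ∀ n, ∀ p ∈ S n, level p ≠ ⊤) : ∃ α < ⊤, ∀ n, ∀ p ∈ S n, level p ≤ α := by
  have hω : ℵ₀ < (ω_ 1).cof := cof_omega_one ▸ Cardinal.aleph0_lt_aleph_one
  obtain ⟨α₀, hα₀, -⟩ := exists_lt_top_of_mk_lt_cof (o := ω_ 1) (ι := Empty) (f := Empty.elim)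
    (lt_trans (by simpa using Cardinal.aleph0_pos) hω) (fun i => i.elim)
  have h1 : ∀ n, ∃ α : OrdSpace (ω_ 1), α < ⊤ ∧ ∀ p ∈ S n, level p ≤ α := by
    intro n
    rcases (S n).eq_empty_or_nonempty with h | h
    · exact ⟨α₀, hα₀, by simp [h]⟩
    · obtain ⟨p, hp, hmax⟩ := (hS n).isCompact.exists_isMaxOn h level.continuous.continuousOn
      exact ⟨level p, lt_top_iff_ne_top.mpr (htop n p hp), fun q hq => hmax hq⟩
  choose a ha haS using h1
  obtain ⟨b, hb, hab⟩ := exists_lt_top_of_mk_lt_cof (by simp) ha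
  exact ⟨b, hb, fun n p hp => (haS n p hp).trans (hab n).le⟩

/-- A clopen set of `βℕ` separates the signs of the restriction of a function `f` to `βℕ`. The
preimage of that set under the retraction separates the signs of `f` up to a set contained in some
`V α`, and there the `F`-space `Y*` takes over. -/
theorem isFSpace : IsFSpace Omega := by
  classical
  have := CompactT2.Projective.extremallyDisconnected (StoneCech.projective (X := ℕ))
  rw [isFSpace_iff_exists_separating]
  intro f
  let E : Set (StoneCech ℕ) := closure {z | 0 < f (inr z)}
  have hE : IsClopen E := ⟨isClosed_closure, ExtremallyDisconnected.open_closure _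
    (isOpen_lt continuous_const (f.continuous.comp inr.continuous))⟩
  have hE0 : ∀ z ∈ E, 0 ≤ f (inr z) := fun z hz =>
    closure_minimal (t := {z | 0 ≤ f (inr z)}) (fun z (hz : 0 < f (inr z)) => hz.le)
      (isClosed_le continuous_const (f.continuous.comp inr.continuous)) hz
  have hE1 : ∀ z, 0 < f (inr z) → z ∈ E := fun z hz => subset_closure hz
  have hQ : IsClopen (ret ⁻¹' E) := hE.preimage ret.continuous
  obtain ⟨α, hα, hαS⟩ := exists_level_le_of_isClosed
    (S := fun n => ret ⁻¹' E ∩ {p | f p ≤ -(1 / ((n : ℝ) + 1))} ∪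
      (ret ⁻¹' E)ᶜ ∩ {p | 1 / ((n : ℝ) + 1) ≤ f p})
    (fun n => (hQ.isClosed.inter (isClosed_le f.continuous continuous_const)).union
      (hQ.compl.isClosed.inter (isClosed_le continuous_const f.continuous))) (by
    intro n p hp htop
    have hpos : 0 < 1 / ((n : ℝ) + 1) := by positivity
    rw [← inr_ret_of_level_eq_top htop] at hp
    rcases hp with ⟨h1, h2⟩ | ⟨h1, h2⟩
    · have h3 := hE0 _ h1
      have h4 : f (inr (ret p)) ≤ -(1 / ((n : ℝ) + 1)) := h2
      rw [ret_inr] at h3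
      linarith
    · have h4 : 1 / ((n : ℝ) + 1) ≤ f (inr (ret p)) := h2
      exact h1 (hE1 _ (hpos.trans_le h4)))
  have hneg : ∀ p, f p < 0 → ret p ∈ E → level p ≤ α := by
    intro p hp hpE
    obtain ⟨n, hn⟩ := exists_nat_one_div_lt (neg_pos.mpr hp)
    exact hαS n p (Or.inl ⟨hpE, by rw [mem_ofPred_eq]; linarith⟩)
  have hpos : ∀ p, 0 < f p → ret p ∉ E → level p ≤ α := by
    intro p hp hpE
    obtain ⟨n, hn⟩ := exists_nat_one_div_lt hp
    exact hαS n p (Or.inr ⟨hpE, hn.le⟩)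
  obtain ⟨h, h1, h0⟩ := isFSpace_iff_exists_separating.mp
    (isFSpace_remainder_nat_prod (H := G)) (f.comp inl)
  have hind : Continuous (E.indicator (fun _ => (1 : ℝ))) :=
    continuous_const.indicator (by simp [hE.frontier_eq])
  let W : Set (Remainder Y) := {y | level (inl y) ≤ α}
  have hW : IsClopen W := (isClopen_level_le α).preimage inl.continuous
  let g : C(Remainder Y, ℝ) := ⟨W.piecewise h fun y => E.indicator (fun _ => 1) (ret (inl y)),
    h.continuous.piecewise (by simp [hW.frontier_eq])
      (hind.comp (ret.continuous.comp inl.continuous))⟩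
  have hgW : ∀ y, level (inl y) ≤ α → g y = h y := fun y hy =>
    piecewise_eq_of_mem W h (fun y => E.indicator (fun _ => (1 : ℝ)) (ret (inl y))) hy
  have hgW' : ∀ y, ¬ level (inl y) ≤ α → g y = E.indicator (fun _ => 1) (ret (inl y)) :=
    fun y hy => piecewise_eq_of_notMem W h
      (fun y => E.indicator (fun _ => (1 : ℝ)) (ret (inl y))) hy
  refine ⟨glue g ⟨_, hind⟩ fun y => ?_, fun p hp => ?_, fun p hp => ?_⟩
  · have hy : inl y.1 = inr (restr y) := inl_eq_inr_restr y
    rw [hgW' _ (by rw [hy, level_inr]; exact not_le.mpr hα), hy, ret_inr]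
    rfl
  · obtain ⟨y, rfl⟩ | ⟨z, rfl⟩ := cases p
    · rw [glue_inl]
      by_cases hy : level (inl y) ≤ α
      · rw [hgW y hy, h1 y hp]
      · rw [hgW' y hy, indicator_of_mem]
        by_contra hyE
        exact hy (hpos _ hp hyE)
    · exact indicator_of_mem (hE1 z hp) (fun _ => (1 : ℝ))
  · obtain ⟨y, rfl⟩ | ⟨z, rfl⟩ := cases p
    · rw [glue_inl]
      by_cases hy : level (inl y) ≤ α
      · rw [hgW y hy, h0 y hp]
      · rw [hgW' y hy, indicator_of_notMem]
        exact fun hyE => hy (hneg _ hp hyE)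
    · exact indicator_of_notMem (fun hz => absurd hp (not_lt.mpr (hE0 z hz))) (fun _ => (1 : ℝ))

end Omega

/-! ### The spaces `K` and `U` -/

theorem isFSpace_K : IsFSpace K := (isPSpace_X.isFSpace_prod Omega.isFSpace).stoneCech

instance : TotallySeparatedSpace K :=
  (isPSpace_X.isStronglyZeroDim_prod
    isStronglyZeroDim_of_compactSpace).totallySeparatedSpace_stoneCech

theorem isOpen_U : IsOpen U := isClosed_closure.isOpen_compl

theorem clK_subset_U {D : Set (X × Omega)} (hD : IsClopen D) (hDL : Disjoint D (L ×ˢ C)) :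
    clK D ⊆ U := by
  intro p hp hpT
  have : p ∈ clK Dᶜ := closure_mono (image_mono hDL.subset_compl_left) hpT
  rw [clK, ← compl_closure_image_unit hD] at this
  exact this hp

theorem level_of_mem_C {p : Omega} (hp : p ∈ C) : Omega.level p = ⊤ := by
  obtain ⟨n, rfl⟩ := hp
  rfl

theorem disjoint_V_prod {α : OrdSpace (ω_ 1)} (hα : α < ⊤) :
    Disjoint (univ ×ˢ V α : Set (X × Omega)) (L ×ˢ C) := by
  rw [Set.disjoint_left]
  rintro ⟨x, p⟩ ⟨-, h⟩ ⟨-, hp⟩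
  rw [Omega.mem_V_iff hα, level_of_mem_C hp] at h
  exact absurd hα (not_lt.mpr h)

theorem disjoint_prod_of_subset_compl_L {A : Set X} (hA : A ⊆ Lᶜ) (B : Set Omega) :
    Disjoint (A ×ˢ B) (L ×ˢ C) :=
  Set.disjoint_prod.mpr (Or.inl (disjoint_compl_left.mono_left hA))

theorem isClopen_V_prod {α : OrdSpace (ω_ 1)} (hα : α < ⊤) :
    IsClopen (univ ×ˢ V α : Set (X × Omega)) := isClopen_univ.prod (Omega.isClopen_V hα)

theorem unit_mem_U {x : X} {p : Omega} (h : x ∉ L ∨ Omega.level p ≠ ⊤) :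
    (stoneCechUnit (x, p) : K) ∈ U := by
  rcases h with h | h
  · have hx : ({x} : Set X) ⊆ Lᶜ := singleton_subset_iff.mpr h
    exact clK_subset_U ((isClopen_of_countable (countable_singleton x) hx).prod isClopen_univ)
      (disjoint_prod_of_subset_compl_L hx univ)
      (subset_closure (mem_image_of_mem _ ⟨rfl, mem_univ p⟩))
  · have hp := lt_top_iff_ne_top.mpr h
    exact clK_subset_U (isClopen_V_prod hp) (disjoint_V_prod hp)
      (subset_closure (mem_image_of_mem _ ⟨mem_univ x, (Omega.mem_V_iff hp).mpr le_rfl⟩))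

theorem exists_clopen_of_mem_U {p : K} (hp : p ∈ U) :
    ∃ D : Set (X × Omega), IsClopen D ∧ p ∈ clK D ∧ Disjoint D (L ×ˢ C) := by
  obtain ⟨E, hE, hpE, hEU⟩ := isTopologicalBasis_isClopen.exists_subset_of_mem_open hp isOpen_U
  refine ⟨stoneCechUnit ⁻¹' E, hE.preimage continuous_stoneCechUnit, ?_, ?_⟩
  · rwa [clK, closure_image_preimage_unit hE]
  · rw [Set.disjoint_left]
    exact fun q hq hqT => hEU hq (subset_closure (mem_image_of_mem _ hqT))

/-- The section of `D` at a point of `L` is a closed set disjoint from `βℕ`, hence contained in some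
`V α`. As sections are locally constant and `L` is Lindelöf, a single `α` serves for a neighbourhood
of `L`, and the complement of such a neighbourhood is countable. -/
theorem exists_subset_of_disjoint {D : Set (X × Omega)} (hD : IsClopen D)
    (hDL : Disjoint D (L ×ˢ C)) : ∃ α < ⊤, ∃ A : Set X, A.Countable ∧ A ⊆ Lᶜ ∧
      D ⊆ univ ×ˢ V α ∪ A ×ˢ univ := by
  have hpair : ∀ x : X, Continuous fun p : Omega => (x, p) := fun x => by fun_prop
  have htop : ∀ x ∈ L, ∀ p, (x, p) ∈ D → Omega.level p ≠ ⊤ := by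
    intro x hx p hp hlev
    have hcl : p ∈ closure C := by
      rw [← Omega.inr_ret_of_level_eq_top hlev]
      exact Omega.inr_mem_closure_C _
    obtain ⟨q, hqD, hqC⟩ := mem_closure_iff.mp hcl _ (hD.isOpen.preimage (hpair x)) hp
    exact Set.disjoint_left.mp hDL hqD ⟨hx, hqC⟩
  have hα : ∀ x ∈ L, ∃ α : OrdSpace (ω_ 1), α < ⊤ ∧ ∀ p, (x, p) ∈ D → Omega.level p ≤ α := by
    intro x hx
    obtain ⟨α, hα, h⟩ := Omega.exists_level_le_of_isClosed (S := fun _ => {p | (x, p) ∈ D})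
      (fun _ => hD.isClosed.preimage (hpair x)) fun _ => htop x hx
    exact ⟨α, hα, h 0⟩
  choose! a ha haD using hα
  let f : C(X × Omega, ℝ) := ⟨D.indicator 1,
    (continuous_const (y := (1 : ℝ))).indicator (by simp [hD.frontier_eq])⟩
  have hf : ∀ q, q ∈ D ↔ f q = 1 := by
    intro q
    change q ∈ D ↔ D.indicator (1 : X × Omega → ℝ) q = 1
    by_cases hq : q ∈ D <;> simp [hq]
  let N : X → Set X := fun x => {x' | f.curry x' = f.curry x}
  have hN : ∀ x, IsOpen (N x) := fun x => (isPSpace_X.isLocallyConstant_curry f).isOpen_fiber _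
  have hND : ∀ x, ∀ x' ∈ N x, ∀ p, (x', p) ∈ D → (x, p) ∈ D := by
    intro x x' hx' p hp
    rw [hf] at hp ⊢
    exact (DFunLike.congr_fun (show f.curry x' = f.curry x from hx') p).symm.trans hp
  have hL : IsLindelof L := isLindelof_univ_X.of_isClosed_subset isClosed_L (subset_univ L)
  obtain ⟨r, hr, hLr⟩ := hL.elim_countable_subcover (fun x : L => N x) (fun x => hN x)
    fun x hx => mem_iUnion.mpr ⟨⟨x, hx⟩, show f.curry x = f.curry x from rfl⟩
  obtain ⟨α, hα, hrα⟩ := exists_lt_top_of_mk_lt_cof (o := ω_ 1) (ι := r) (f := fun x => a x.1)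
    (hr.le_aleph0.trans_lt (cof_omega_one ▸ Cardinal.aleph0_lt_aleph_one)) fun x => ha _ x.1.2
  have hAL : (⋃ x ∈ r, N x)ᶜ ⊆ Lᶜ := compl_subset_compl.mpr hLr
  have hNr : IsOpen (⋃ x ∈ r, N x) := isOpen_biUnion fun x _ => hN x
  refine ⟨α, hα, _, countable_of_isClosed hNr.isClosed_compl hAL, hAL, ?_⟩
  rintro ⟨x, p⟩ hp
  by_cases hx : x ∈ ⋃ y ∈ r, N y
  · obtain ⟨y, hy, hxy⟩ := mem_iUnion₂.mp hx
    exact Or.inl ⟨mem_univ x, (Omega.mem_V_iff hα).mpr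
      ((haD y y.2 p (hND y x hxy p hp)).trans (hrα ⟨y, hy⟩).le)⟩
  · exact Or.inr ⟨hx, mem_univ p⟩

theorem exists_cover_of_mem_U {p : K} (hp : p ∈ U) : ∃ α < ⊤, ∃ A : Set X, A.Countable ∧ A ⊆ Lᶜ ∧
    p ∈ clK (univ ×ˢ V α) ∪ clK (A ×ˢ univ) := by
  obtain ⟨D, hD, hpD, hDL⟩ := exists_clopen_of_mem_U hp
  obtain ⟨α, hα, A, hA, hAL, hsub⟩ := exists_subset_of_disjoint hD hDL
  refine ⟨α, hα, A, hA, hAL, ?_⟩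
  rw [clK, clK, ← closure_union, ← image_union]
  exact closure_mono (image_mono hsub) hpD

/-! ### `U` is not an `F`-space -/

theorem Omega.level_of_ret_mem_range {p : Omega} (h : ret p ∈ range stoneCechUnit) :
    level p = ⊤ := by
  obtain ⟨y, rfl⟩ | ⟨z, rfl⟩ := cases p
  · have h1 : ret (inl y) = (toProd (piStar y)).1 := rfl
    change (toProd (piStar y)).2 = ⊤
    obtain ⟨q | z, hq⟩ := Quot.exists_rep (piStar y)
    · rw [h1, ← hq] at h
      exact absurd h q.1.2
    · rw [← hq]
      rfl
  · rfl

theorem Omega.isClopen_singleton_inr_unit (n : ℕ) : IsClopen {inr (stoneCechUnit n)} := by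
  have h1 : ({stoneCechUnit n} : Set (StoneCech ℕ)) = closure (stoneCechUnit '' {n}) := by
    rw [image_singleton, closure_singleton]
  have h2 : {inr (stoneCechUnit n)} = ret ⁻¹' {stoneCechUnit n} := by
    ext p
    simp only [mem_singleton_iff, mem_preimage]
    refine ⟨fun h => by rw [h, ret_inr], fun h => ?_⟩
    rw [← h, inr_ret_of_level_eq_top (level_of_ret_mem_range (h ▸ mem_range_self n))]
  rw [h2, h1]
  exact (isClopen_closure_image_unit (isClopen_discrete {n})).preimage ret.continuous

/-- For a set `S` disjoint from `L`, the union in `U` of the closures of the sets `A × {n}`, where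
`n ∈ C` and `A` is a countable subset of `S`. -/
def layer (S : Set X) (n : ℕ) : Set U :=
  ⋃ A ∈ {A : Set X | A.Countable ∧ A ⊆ S}, Subtype.val ⁻¹' clK (A ×ˢ {Omega.inr (stoneCechUnit n)})

theorem isClopen_prod_singleton {A : Set X} (hA : A.Countable) (hAL : A ⊆ Lᶜ) (n : ℕ) :
    IsClopen (A ×ˢ {Omega.inr (stoneCechUnit n)}) :=
  (isClopen_of_countable hA hAL).prod (Omega.isClopen_singleton_inr_unit n)

theorem isOpen_layer {S : Set X} (hS : S ⊆ Lᶜ) (n : ℕ) : IsOpen (layer S n) :=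
  isOpen_biUnion fun _ hA => (isClopen_closure_image_unit
    (isClopen_prod_singleton hA.1 (hA.2.trans hS) n)).isOpen.preimage continuous_subtype_val

theorem disjoint_closure_image_unit {Z : Type*} [TopologicalSpace Z] {D E : Set Z}
    (hD : IsClopen D) (hDE : Disjoint D E) :
    Disjoint (closure (stoneCechUnit '' D)) (closure (stoneCechUnit '' E)) := by
  rw [← subset_compl_iff_disjoint_left, compl_closure_image_unit hD]
  exact closure_mono (image_mono hDE.subset_compl_left)

theorem disjoint_layer {S R : Set X} (hS : S ⊆ Lᶜ) (hSR : Disjoint S R) (m n : ℕ) :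
    Disjoint (layer S m) (layer R n) := by
  simp only [layer, disjoint_iUnion_left, disjoint_iUnion_right]
  intro A hA B hB
  exact (disjoint_closure_image_unit (isClopen_prod_singleton hB.1 (hB.2.trans hS) m)
    (Set.disjoint_prod.mpr (Or.inl (hSR.mono hB.2 hA.2)))).preimage _

/-- The complement of a layer consists of the complementary layer and of the points outside the
clopen set `cl (X × {n})`. -/
theorem isClopen_layer {S : Set X} (hS : S ⊆ Lᶜ) (n : ℕ) : IsClopen (layer S n) := by
  have hE : IsClopen (univ ×ˢ {Omega.inr (stoneCechUnit n)} : Set (X × Omega)) :=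
    isClopen_univ.prod (Omega.isClopen_singleton_inr_unit n)
  have hcompl : (layer S n)ᶜ = layer (Lᶜ \ S) n ∪
      Subtype.val ⁻¹' (clK (univ ×ˢ {Omega.inr (stoneCechUnit n)}))ᶜ := by
    ext u
    constructor
    · intro hu
      by_cases huE : u.1 ∈ clK (univ ×ˢ {Omega.inr (stoneCechUnit n)})
      swap
      · exact Or.inr huE
      obtain ⟨α, hα, A, hA, hAL, hcov⟩ := exists_cover_of_mem_U u.2
      have hV : u.1 ∉ clK (univ ×ˢ V α) := fun h =>
        Set.disjoint_left.mp (disjoint_closure_image_unit hE (E := univ ×ˢ V α)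
          (Set.disjoint_prod.mpr (Or.inr (by
            rw [disjoint_singleton_left, Omega.mem_V_iff hα, Omega.level_inr]
            exact not_le.mpr hα)))) huE h
      have hsub : (univ ×ˢ {Omega.inr (stoneCechUnit n)} : Set (X × Omega)) ⊆
          (A ×ˢ univ)ᶜ ∪ ((A ∩ S) ×ˢ {Omega.inr (stoneCechUnit n)} ∪
            (A \ S) ×ˢ {Omega.inr (stoneCechUnit n)}) := by
        rintro ⟨x, p⟩ ⟨-, hp⟩
        by_cases hxA : x ∈ A
        · by_cases hxS : x ∈ S
          · exact Or.inr (Or.inl ⟨⟨hxA, hxS⟩, hp⟩)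
          · exact Or.inr (Or.inr ⟨⟨hxA, hxS⟩, hp⟩)
        · exact Or.inl fun h => hxA h.1
      have hu' := closure_mono (image_mono hsub) huE
      rw [image_union, image_union, closure_union, closure_union,
        ← compl_closure_image_unit ((isClopen_of_countable hA hAL).prod isClopen_univ)] at hu'
      rcases hu' with h | h | h
      · exact absurd (hcov.resolve_left hV) h
      · exact absurd (mem_biUnion (t := fun A => Subtype.val ⁻¹'
          clK (A ×ˢ {Omega.inr (stoneCechUnit n)}))
          (show A ∩ S ∈ {A : Set X | A.Countable ∧ A ⊆ S} from
            ⟨hA.mono inter_subset_left, inter_subset_right⟩) h) hu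
      · exact Or.inl (mem_biUnion (show A \ S ∈ {A : Set X | A.Countable ∧ A ⊆ Lᶜ \ S} from
          ⟨hA.mono sdiff_subset, fun x hx => ⟨hAL hx.1, hx.2⟩⟩) h)
    · rintro (h | h) hu
      · exact Set.disjoint_left.mp (disjoint_layer hS disjoint_sdiff_right n n) hu h
      · obtain ⟨A, hA, hu⟩ := mem_iUnion₂.mp hu
        exact h (closure_mono (image_mono (prod_mono_left (subset_univ A))) hu)
  refine ⟨?_, isOpen_layer hS n⟩
  rw [← isOpen_compl_iff, hcompl]
  exact (isOpen_layer (fun x hx => hx.1) n).union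
    ((isClopen_closure_image_unit hE).compl.isOpen.preimage continuous_subtype_val)

theorem mem_layer {S : Set X} {x : X} (hx : x ∈ S) (hxL : x ∉ L) (n : ℕ) :
    (⟨stoneCechUnit (x, Omega.inr (stoneCechUnit n)), unit_mem_U (Or.inl hxL)⟩ : U) ∈
      layer S n := by
  refine mem_biUnion (show {x} ∈ {A : Set X | A.Countable ∧ A ⊆ S} from
    ⟨countable_singleton x, singleton_subset_iff.mpr hx⟩) ?_
  exact subset_closure (mem_image_of_mem _ ⟨rfl, rfl⟩)

/-- If `h` takes the value `c` on `{x} × C`, then it takes values close to `c` on `{x} × (Ω \ V α)`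
for some `α`. -/
theorem exists_level_close (h : C(U, ℝ)) {x : X} (hx : x ∉ L) {c : ℝ}
    (hc : ∀ n : ℕ, h ⟨stoneCechUnit (x, Omega.inr (stoneCechUnit n)), unit_mem_U (Or.inl hx)⟩ = c) :
    ∃ α < ⊤, ∀ p : Omega, α < Omega.level p →
      |h ⟨stoneCechUnit (x, p), unit_mem_U (Or.inl hx)⟩ - c| < 1 / 4 := by
  let k : C(Omega, ℝ) := h.comp ⟨fun p => ⟨stoneCechUnit (x, p), unit_mem_U (Or.inl hx)⟩,
    (continuous_stoneCechUnit.comp (Continuous.prodMk_right x)).subtype_mk _⟩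
  have hk : ∀ p, Omega.level p = ⊤ → k p = c := by
    intro p hp
    have hcl : p ∈ closure C := by
      rw [← Omega.inr_ret_of_level_eq_top hp]
      exact Omega.inr_mem_closure_C _
    refine closure_minimal (t := {p | k p = c}) ?_ (isClosed_eq k.continuous continuous_const) hcl
    rintro _ ⟨n, rfl⟩
    exact hc n
  obtain ⟨α, hα, hS⟩ := Omega.exists_level_le_of_isClosed (S := fun _ => {p | 1 / 4 ≤ |k p - c|})
    (fun _ => isClosed_le continuous_const (k.continuous.sub continuous_const).abs) (by
      intro _ p hp htop
      rw [mem_ofPred_eq, hk p htop, sub_self, abs_zero] at hp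
      norm_num at hp)
  refine ⟨α, hα, fun p hp => ?_⟩
  by_contra! hle
  exact absurd hp (not_lt.mpr (hS 0 p hle))

/-- A function on `U` is determined near `ω₂` by its values at `ω₂`, simultaneously on `ω₁` many
levels below the top. -/
theorem exists_Ioi_close (h : C(U, ℝ)) (v : OrdSpace (ω_ 1) → Omega)
    (hv : ∀ α, Omega.level (v α) = α) : ∃ γ : X, γ < ⊤ ∧ ∀ x : X, γ < x →
      ∀ (α : OrdSpace (ω_ 1)) (hα : α < ⊤),
      |h ⟨stoneCechUnit (x, v α), unit_mem_U (Or.inr ((hv α).trans_ne hα.ne))⟩ -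
        h ⟨stoneCechUnit (⊤, v α), unit_mem_U (Or.inr ((hv α).trans_ne hα.ne))⟩| < 1 / 4 := by
  have h1 : ∀ α : Iio (⊤ : OrdSpace (ω_ 1)), ∃ γ : X, γ < ⊤ ∧ ∀ x : X, γ < x →
      |h ⟨stoneCechUnit (x, v α), unit_mem_U (Or.inr ((hv α).trans_ne (ne_of_lt α.2)))⟩ -
        h ⟨stoneCechUnit (⊤, v α), unit_mem_U (Or.inr ((hv α).trans_ne (ne_of_lt α.2)))⟩|
        < 1 / 4 := by
    intro α
    let k : C(X, ℝ) := h.comp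
      ⟨fun x => ⟨stoneCechUnit (x, v α), unit_mem_U (Or.inr ((hv α).trans_ne (ne_of_lt α.2)))⟩,
        (continuous_stoneCechUnit.comp (Continuous.prodMk_left (v α))).subtype_mk _⟩
    obtain ⟨γ, hγ, hsub⟩ := exists_Ioi_subset_of_top_mem (U := {x | |k x - k ⊤| < 1 / 4})
      (isOpen_lt (k.continuous.sub continuous_const).abs continuous_const) (by
        rw [mem_ofPred_eq, sub_self, abs_zero]
        norm_num)
    exact ⟨γ, hγ, fun x hx => hsub hx⟩
  choose g hg hgh using h1
  have hcard : #(Iio (⊤ : OrdSpace (ω_ 1))) < (ω_ 2).cof := by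
    rw [cof_omega_two]
    refine (Cardinal.mk_set_le _).trans_lt ?_
    rw [mk_ordSpace_omega_one]
    exact aleph_one_lt_aleph_two
  obtain ⟨γ, hγ, hgγ⟩ := exists_lt_top_of_mk_lt_cof (o := ω_ 2) hcard hg
  exact ⟨γ, hγ, fun x hx α hα => hgh ⟨α, hα⟩ x ((hgγ ⟨α, hα⟩).trans hx)⟩

/-- Let `S` and `R` consist of the successors and of the other isolated points of `X`. The union of
the layers of `S` and that of the layers of `R` are disjoint cozero-sets. A function `h` that
separates them is close to `1` on most of `{x} × Ω`, for `x` in `S`, and close to `0` on most of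
`{y} × Ω`, for `y` in `R`. For `x` and `y` close to `ω₂` this is impossible: there, `h (x, v)` and
`h (y, v)` are close to `h (ω₂, v)`, for `ω₁` many points `v` of increasing levels. -/
theorem not_isFSpace_U : ¬ IsFSpace U := by
  intro hU
  let S : Set X := {x | x ∉ L ∧ ∃ y, y ⋖ x}
  let R : Set X := {x | x ∉ L ∧ ¬ ∃ y, y ⋖ x}
  have hS : S ⊆ Lᶜ := fun x hx => hx.1
  have hR : R ⊆ Lᶜ := fun x hx => hx.1
  have hSR : Disjoint S R := Set.disjoint_left.mpr fun x hx hx' => hx'.2 hx.2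
  obtain ⟨h, h1, h0⟩ := exists_separating_of_disjoint (isFSpace_iff_exists_separating.mp hU)
    (isCozeroSet_iUnion_of_isClopen fun n => isClopen_layer hS n)
    (isCozeroSet_iUnion_of_isClopen fun n => isClopen_layer hR n) (by
      simp only [disjoint_iUnion_left, disjoint_iUnion_right]
      exact fun m n => disjoint_layer hS hSR n m)
  choose v hv using Omega.exists_level_eq
  obtain ⟨γ, hγ, hclose⟩ := exists_Ioi_close h v hv
  obtain ⟨x, -, hγx⟩ := exists_covBy_lt_top (o := ω_ 2) aleph0_lt_cof_omega_two.le hγ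
  obtain ⟨y, -, hγy, hycof, hylim⟩ := exists_limit_lt_top (o := ω_ 2) aleph0_lt_cof_omega_two hγ
  have hxL : (x : X) ∉ L := by
    refine notMem_L_iff.mpr ?_
    refine (Order.cof_le (s := {⟨γ, hγx.lt⟩}) ?_).trans (by simp)
    rintro ⟨z, hz⟩
    exact ⟨_, rfl, hγx.le_of_lt hz⟩
  have hyL : (y : X) ∉ L := notMem_L_iff.mpr hycof
  obtain ⟨α, hα, hxα⟩ := exists_level_close h hxL (c := 1) fun n =>
    h1 _ (mem_iUnion.mpr ⟨n, mem_layer (show x ∈ S from ⟨hxL, γ, hγx⟩) hxL n⟩)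
  obtain ⟨β, hβ, hyβ⟩ := exists_level_close h hyL (c := 0) fun n =>
    h0 _ (mem_iUnion.mpr ⟨n, mem_layer (show y ∈ R from ⟨hyL, fun ⟨z, hz⟩ => hylim z hz⟩) hyL n⟩)
  obtain ⟨δ, hδ, hlt⟩ := exists_lt_top_of_mk_lt_cof (o := ω_ 1) (ι := Unit)
    (f := fun _ => max α β) (by
      rw [cof_omega_one, Cardinal.mk_unit]
      exact Cardinal.one_lt_aleph0.trans Cardinal.aleph0_lt_aleph_one) fun _ => max_lt hα hβ
  have e1 := abs_lt.mp (hxα (v δ) (by rw [hv]; exact (le_max_left _ _).trans_lt (hlt ())))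
  have e2 := abs_lt.mp (hyβ (v δ) (by rw [hv]; exact (le_max_right _ _).trans_lt (hlt ())))
  have e3 := abs_lt.mp (hclose x hγx.lt δ hδ)
  have e4 := abs_lt.mp (hclose y hγy δ hδ)
  linarith [e1.1, e2.2, e3.2, e4.1]

/-! ### The cover of `U` -/

/-- The cover of `U` by clopen sets of `K` that is given by a family of subsets of `X`. -/
def clopenCover (𝒜 : Set (Set X)) : Set (Set K) :=
  {D | ∃ α : OrdSpace (ω_ 1), α < ⊤ ∧ D = clK (univ ×ˢ V α)} ∪ {D | ∃ A ∈ 𝒜, D = clK (A ×ˢ univ)}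

theorem isClopen_of_mem_clopenCover {𝒜 : Set (Set X)} (h𝒜 : ∀ A ∈ 𝒜, A.Countable ∧ A ⊆ Lᶜ)
    {D : Set K} (hD : D ∈ clopenCover 𝒜) : IsClopen D ∧ D ⊆ U := by
  rcases hD with ⟨α, hα, rfl⟩ | ⟨A, hA, rfl⟩
  · exact ⟨isClopen_closure_image_unit (isClopen_V_prod hα),
      clK_subset_U (isClopen_V_prod hα) (disjoint_V_prod hα)⟩
  · obtain ⟨hc, hL⟩ := h𝒜 A hA
    have := (isClopen_of_countable hc hL).prod (isClopen_univ (X := Omega))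
    exact ⟨isClopen_closure_image_unit this,
      clK_subset_U this (disjoint_prod_of_subset_compl_L hL univ)⟩

theorem sUnion_clopenCover {𝒜 : Set (Set X)} (h𝒜 : ∀ A ∈ 𝒜, A.Countable ∧ A ⊆ Lᶜ)
    (hcof : ∀ B : Set X, B.Countable → B ⊆ Lᶜ → ∃ A ∈ 𝒜, B ⊆ A) : ⋃₀ clopenCover 𝒜 = U := by
  refine subset_antisymm (sUnion_subset fun D hD => (isClopen_of_mem_clopenCover h𝒜 hD).2)
    fun p hp => ?_
  obtain ⟨α, hα, B, hB, hBL, h | h⟩ := exists_cover_of_mem_U hp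
  · exact ⟨_, Or.inl ⟨α, hα, rfl⟩, h⟩
  · obtain ⟨A, hA, hBA⟩ := hcof B hB hBL
    exact ⟨_, Or.inr ⟨A, hA, rfl⟩, closure_mono (image_mono (prod_mono_left hBA)) h⟩

theorem mk_clopenCover {𝒜 : Set (Set X)} (h𝒜 : ∀ A ∈ 𝒜, A.Countable ∧ A ⊆ Lᶜ)
    (hcard : #𝒜 = ℵ_ 2) : #(clopenCover 𝒜) = ℵ_ 2 := by
  apply le_antisymm
  · have h1 : {D | ∃ α : OrdSpace (ω_ 1), α < ⊤ ∧ D = clK (univ ×ˢ V α)} ⊆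
        range fun α : OrdSpace (ω_ 1) => clK (univ ×ˢ V α) := by
      rintro _ ⟨α, -, rfl⟩
      exact mem_range_self α
    have h2 : {D | ∃ A ∈ 𝒜, D = clK (A ×ˢ univ)} = (fun A => clK (A ×ˢ univ)) '' 𝒜 := by
      ext D
      exact exists_congr fun A => and_congr_right fun _ => eq_comm
    refine (Cardinal.mk_union_le _ _).trans ?_
    rw [h2]
    refine (add_le_add ((Cardinal.mk_le_mk_of_subset h1).trans Cardinal.mk_range_le)
      Cardinal.mk_image_le).trans ?_
    rw [hcard, mk_ordSpace_omega_one,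
      Cardinal.add_eq_right aleph0_lt_aleph_two.le aleph_one_lt_aleph_two.le]
  · -- a clopen set `A × Ω` is recovered from its closure in `K`
    rw [← hcard]
    refine Cardinal.mk_le_of_injective
      (f := fun A : 𝒜 => (⟨clK (A.1 ×ˢ univ), Or.inr ⟨A.1, A.2, rfl⟩⟩ : clopenCover 𝒜)) ?_
    intro A B hAB
    have hAB' : clK (A.1 ×ˢ univ) = clK (B.1 ×ˢ univ) := Subtype.mk.inj hAB
    obtain ⟨p, -⟩ := Omega.exists_level_eq ⊤
    have hmem : ∀ (A : 𝒜) (x : X), (stoneCechUnit (x, p) : K) ∈ clK (A.1 ×ˢ univ) ↔ x ∈ A.1 := by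
      intro A x
      obtain ⟨hc, hL⟩ := h𝒜 A A.2
      rw [clK, unit_mem_closure_image_iff ((isClopen_of_countable hc hL).prod isClopen_univ)]
      simp
    exact Subtype.ext (Set.ext fun x => by rw [← hmem A, ← hmem B, hAB'])

theorem isZeroDim_of_isClopen {D : Set K} (hD : IsClopen D) : IsZeroDim D := by
  have : CompactSpace D := isCompact_iff_compactSpace.mp hD.isClosed.isCompact
  exact isTopologicalBasis_isClopen

theorem isFSpace_preimage_of_isClopen {D : Set K} (hD : IsClopen D) (hDU : D ⊆ U) :
    IsFSpace (Subtype.val ⁻¹' D : Set U) := by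
  refine IsFSpace.of_isClopen_range
    (e := fun p : (Subtype.val ⁻¹' D : Set U) => (p.1.1 : K))
    (IsEmbedding.subtypeVal.comp IsEmbedding.subtypeVal) ?_ isFSpace_K
  convert hD
  ext p
  exact ⟨by rintro ⟨q, rfl⟩; exact q.2, fun hp => ⟨⟨⟨p, hDU hp⟩, hp⟩, rfl⟩⟩

/-- The space `U`, with its cover by the traces of clopen sets of `K`, is a counterexample. -/
theorem not_unionTheorem : ¬ UnionTheorem (ℵ_ 2) := by
  intro hUT
  obtain ⟨𝒜, hcard, h𝒜, hcof⟩ := exists_cofinal_family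
  have h𝒜' : ∀ A ∈ 𝒜, A.Countable ∧ A ⊆ Lᶜ := fun A hA => ⟨(h𝒜 A hA).1, (h𝒜 A hA).2.2⟩
  refine not_isFSpace_U (hUT U ((fun D => Subtype.val ⁻¹' D) '' clopenCover 𝒜) ?_ ?_ ?_)
  · exact Cardinal.mk_image_le.trans (mk_clopenCover h𝒜' hcard).le
  · refine eq_univ_of_forall fun u => ?_
    obtain ⟨D, hD, hu⟩ := (sUnion_clopenCover h𝒜' hcof).symm.subset u.2
    exact ⟨_, mem_image_of_mem _ hD, hu⟩
  · rintro _ ⟨D, hD, rfl⟩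
    obtain ⟨hc, hDU⟩ := isClopen_of_mem_clopenCover h𝒜' hD
    have hc' : IsClopen (Subtype.val ⁻¹' D : Set U) := hc.preimage continuous_subtype_val
    exact ⟨isPSet_of_isClopen hc', isNicelyPlaced_of_isClopen hc', isCStarEmbedded_of_isClopen hc',
      isFSpace_preimage_of_isClopen hc hDU⟩

end FUnion

theorem mainTheorem2 :
    -- the properties of the spaces `Ω` and `K`
    (CompactSpace FUnion.Omega ∧ T2Space FUnion.Omega ∧
      FUnion.IsZeroDim FUnion.Omega ∧ FUnion.IsFSpace FUnion.Omega) ∧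
    (CompactSpace FUnion.K ∧ T2Space FUnion.K ∧
      FUnion.IsZeroDim FUnion.K ∧ FUnion.IsFSpace FUnion.K) ∧
    -- `U` is an open, locally compact subspace of `K` that is not an F-space
    IsOpen FUnion.U ∧ LocallyCompactSpace FUnion.U ∧ ¬ FUnion.IsFSpace FUnion.U ∧
    -- the cover of `U` by `ω₂` many clopen sets of `K`
    (∃ 𝒜 : Set (Set FUnion.X), #𝒜 = ℵ_ 2 ∧
      (∀ A ∈ 𝒜, A.Countable ∧ A.Infinite ∧ A ⊆ FUnion.Lᶜ) ∧
      (∀ B : Set FUnion.X, B.Countable → B ⊆ FUnion.Lᶜ → ∃ A ∈ 𝒜, B ⊆ A) ∧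
      ∃ F : Set (Set FUnion.K),
        F = {D | ∃ α : FUnion.OrdSpace (ω_ 1), α < ⊤ ∧
              D = FUnion.clK (univ ×ˢ FUnion.V α)} ∪
            {D | ∃ A ∈ 𝒜, D = FUnion.clK (A ×ˢ univ)} ∧
        #F = ℵ_ 2 ∧ ⋃₀ F = FUnion.U ∧
        ∀ D ∈ F, IsClopen D ∧ CompactSpace D ∧ FUnion.IsZeroDim D ∧ FUnion.IsFSpace D ∧
          FUnion.IsPSet ((↑) ⁻¹' D : Set FUnion.U) ∧
          FUnion.IsNicelyPlaced ((↑) ⁻¹' D : Set FUnion.U) ∧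
          FUnion.IsCStarEmbedded ((↑) ⁻¹' D : Set FUnion.U)) ∧
    -- consequently the union theorem fails for covers of size `ω₂`
    ¬ FUnion.UnionTheorem (ℵ_ 2) := by
  obtain ⟨𝒜, hcard, h𝒜, hcof⟩ := FUnion.exists_cofinal_family
  have h𝒜' : ∀ A ∈ 𝒜, A.Countable ∧ A ⊆ FUnion.Lᶜ := fun A hA => ⟨(h𝒜 A hA).1, (h𝒜 A hA).2.2⟩
  refine ⟨⟨inferInstance, inferInstance, isTopologicalBasis_isClopen, FUnion.Omega.isFSpace⟩,
    ⟨inferInstance, inferInstance, isTopologicalBasis_isClopen, FUnion.isFSpace_K⟩,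
    FUnion.isOpen_U, FUnion.isOpen_U.locallyCompactSpace, FUnion.not_isFSpace_U,
    ⟨𝒜, hcard, h𝒜, hcof, FUnion.clopenCover 𝒜, rfl, FUnion.mk_clopenCover h𝒜' hcard,
      FUnion.sUnion_clopenCover h𝒜' hcof, fun D hD => ?_⟩, FUnion.not_unionTheorem⟩
  have hc := (FUnion.isClopen_of_mem_clopenCover h𝒜' hD).1
  have hc' : IsClopen (Subtype.val ⁻¹' D : Set FUnion.U) := hc.preimage continuous_subtype_val
  exact ⟨hc, isCompact_iff_compactSpace.mp hc.isClosed.isCompact, FUnion.isZeroDim_of_isClopen hc,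
    FUnion.isFSpace_K.of_isClopen_range IsEmbedding.subtypeVal (by simpa using hc),
    FUnion.isPSet_of_isClopen hc', FUnion.isNicelyPlaced_of_isClopen hc',
    FUnion.isCStarEmbedded_of_isClopen hc'⟩
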